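/- Let $p$ be a prime, $N\ge 1$ an integer prime to $p$, $K$ a complete normed field extension of $\mathbb{Q}_p$ containing a primitive $N$-th root of unity $\xi$ (for instance $K=\mathbb{Q}_p(\xi)$), and $\alpha\ge 1$ an integer. **Multiple harmonic sums.** A localized word is $w=\big((n_i)_{1\le i\le d};(j_i)_{1\le i\le d+1}\big)$ with $d\ge 0$, $n_i\in\mathbb{Z}$, $j_i\in\mathbb{Z}/N\mathbb{Z}$; it is a (non-localized) word if all $n_i>0$. Put $|w|=n_1+\dots+n_d$. For $\eta\in\{\xi,\xi^{p^\alpha}\}$ and $m\ge 1$, let $$\mathfrak{h}^{\eta}_m(w)=\sum_{0<m_1<\dots<m_d<m}\frac{\big(\frac{\eta^{j_2}}{\eta^{j_1}}\big)^{m_1}\cdots\big(\frac{\eta^{j_{d+1}}}{\eta^{j_d}}\big)^{m_d}\big(\frac{1}{\eta^{j_{d+1}}}\big)^{m}}{m_1^{n_1}\cdots m_d^{n_d}},\qquad \mathrm{har}^{\eta}_m(w)=m^{|w|}\,\mathfrak{h}^{\eta}_m(w).$$ Write $\mathrm{har}_m$ (resp. $\mathrm{har}_{m,\mathrm{loc}}$)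 for the family $(\mathrm{har}^{\xi}_m(w))_w$ over words (resp. localized words), and $\mathrm{har}^{(p^\alpha)}_m$, $\mathrm{har}^{(p^\alpha)}_{m,\mathrm{loc}}$ for the same families with $\eta=\xi^{p^\alpha}$. **Localization map.** Let $\mathrm{loc}^{\Sigma}_\eta$ be the explicit map from localized words $w$ to finite sums $\sum_{w'}w'\otimes P_{w,w'}$, with $w'$ words and $P_{w,w'}\in K[X]$, obtained by eliminating the exponents $n_i\le 0$ one after the other by means of the closed formulas $\sum_{a\le u<b}\zeta^u u^l=\zeta^bQ_{\zeta,l}(b)-\zeta^aQ_{\zeta,l}(a)$, where $\zeta^N=1$, $l\geq 0$, $Q_{\zeta,l}\in K[X]$ (Faulhaber's formula if $\zeta=1$). For a family $g=(g(w'))_{w'}$ over words put $(\mathrm{loc}^\vee_{\eta,m} g)(w)=m^{|w|}\sum_{w'}P_{w,w'}(m)\,m^{-|w'|}g(w')$. **Action localized at the source and target.** Let $g$ be a family over words and $f=(f_m)_{m\geq 1}$ a sequence of families over localized words, with values in $K$; let $\hat g=\mathrm{loc}^\vee_{\xi,p^\alpha}g$ and $\eta=\xi^{p^\alpha}$. For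 a localized word $w$ of depth $d$ and $m\ge 1$, in the sum over $0<m_1<\dots<m_d<p^\alpha m$ write $m_i=p^\alpha u_i+r_i$ with $0\le r_i<p^\alpha$, put $u_0=r_0=0$, and decompose the domain according to which of the following holds, for each $i$: ($D$) $u_{i-1}<u_i$, $r_i=0$; ($S$) $u_{i-1}<u_i$, $r_i>0$; ($C$) $u_{i-1}=u_i$, $0\le r_{i-1}<r_i$. For $r_i>0$ write $m_i^{-n_i}=r_i^{-n_i}\sum_{l_i\ge 0}\binom{-n_i}{l_i}\big(\frac{p^\alpha u_i}{r_i}\big)^{l_i}$. A type $\epsilon\in\{D,S,C\}^d$ cuts $\{1,\dots,d\}$ into an initial block of indices of type $C$ (possibly empty, where $u_i=0$), followed by blocks $[a,b]$ with $\epsilon_a\in\{D,S\}$ and $\epsilon_{a+1}=\dots=\epsilon_b=C$. To a nonempty interval $[c,b]$ associate $\eta^{j_{b+1}}\,\hat g\big((n_i+l_i)_{c\le i\le b};(j_i)_{c\le i\le b+1}\big)$, and to an empty one associate $1$. Then $(g\circ^{\Sigma,\mathrm{loc},\mathrm{loc}}_{\mathrm{har}}f)_m(w)$ is the sum over $(l_1,\dots,l_d)\in\mathbb{N}^d$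 of the sum over $\epsilon$ (with $l_i=0$ for $i$ of type $D$ or in the initial block) of $$\prod_{i:\,\epsilon_i\ne D}\binom{-n_i}{l_i}\cdot\prod_{\text{blocks}}(\text{factor of the interval of indices of type } S \text{ or } C)\cdot m^{|w|-|v|}f_m(v),$$ where $v$ is the localized word with one letter $(t,j_a)$ for each non-initial block $[a,b]$ and last index $j_{d+1}$, with $t=-(l_a+\dots+l_b)$ if $\epsilon_a=S$ and $t=n_a-(l_{a+1}+\dots+l_b)$ if $\epsilon_a=D$. **Action localized at the target.** For a sequence $f=(f_m)_{m\geq 1}$ of families over words, $g\circ^{\Sigma,*,\mathrm{loc}}_{\mathrm{har}}f=g\circ^{\Sigma,\mathrm{loc},\mathrm{loc}}_{\mathrm{har}}\mathrm{loc}^\vee f$, where $(\mathrm{loc}^\vee f)_m=\mathrm{loc}^\vee_{\xi^{p^\alpha},m}f_m$. Call $g$ *summable* if for each $d$ there are $C$ and $0\le\rho<1$ with $|g(w)|\le C\rho^{|w|}$ for all words $w$ of depth $d$. Call $f$ *tempered* if for all $m$, $d$ and $c$ there are $C,e$ with $|f_m(w)|\le C(1+\sum|n_i|)^e\,|m|^{|w|}$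 for all localized words $w$ of depth $d$ with all $n_i\le c$. **Statement.** 1. If $g$ is summable and $f$ is tempered, the series over $(l_1,\dots,l_d)$ defining $(g\circ^{\Sigma,\mathrm{loc},\mathrm{loc}}_{\mathrm{har}}f)_m(w)$ is summable for all $m\ge 1$ and all $w$. For every sequence $f$ of families over words, $\mathrm{loc}^\vee f$ is tempered; hence $g\circ^{\Sigma,*,\mathrm{loc}}_{\mathrm{har}}f$ is defined for every summable $g$ and every $f$. 2. $\mathrm{har}_{p^\alpha}$ is summable, $(\mathrm{har}^{(p^\alpha)}_{m,\mathrm{loc}})_{m\geq 1}$ is tempered, and for all $m\ge 1$ $$\mathrm{har}_{p^\alpha m,\mathrm{loc}}=\big(\mathrm{har}_{p^\alpha}\circ^{\Sigma,\mathrm{loc},\mathrm{loc}}_{\mathrm{har}}\mathrm{har}^{(p^\alpha)}_{\mathbb{N},\mathrm{loc}}\big)_m .$$ 3. $\mathrm{loc}^\vee\,\mathrm{har}^{(p^\alpha)}_{\mathbb{N}}=\mathrm{har}^{(p^\alpha)}_{\mathbb{N},\mathrm{loc}}$, and $$\mathrm{har}_{p^\alpha\mathbb{N},\mathrm{loc}}=\mathrm{har}_{p^\alpha}\circ^{\Sigma,*,\mathrm{loc}}_{\mathrm{har}}\mathrm{har}^{(p^\alpha)}_{\mathbb{N}},$$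 i.e. localized weighted multiple harmonic sums at $p^\alpha m$ are expressed, by convergent series, through the non-localized $\mathrm{har}^{(p^\alpha)}_m$ and $\mathrm{har}_{p^\alpha}$ and powers of $m$. -/

import Mathlib

/-!
# Localized weighted multiple harmonic sums and harmonic actions

Throughout, `ξ` is an `N`-th root of unity in a field `K`.  An index
`((n_1,…,n_d); (ξ^{j_1},…,ξ^{j_{d+1}}))` is encoded as the pair
`([(n_d, j_d), …, (n_1, j_1)], j_{d+1})`, i.e. the list starts with the letter that belongs to
the largest summation variable `m_d`.
-/

namespace HarmonicAction

open Polynomial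

/-- Localized words: exponents `n_i ∈ ℤ`. -/
abbrev LocWord (N : ℕ) := List (ℤ × ZMod N) × ZMod N

/-- Non-localized words: exponents `n_i ∈ ℕ^*`. -/
abbrev HarWord (N : ℕ) := List (ℕ+ × ZMod N) × ZMod N

/-- A non-localized word seen as a localized word. -/
def HarWord.toLoc {N : ℕ} (w : HarWord N) : LocWord N :=
  (w.1.map fun a => ((a.1 : ℤ), a.2), w.2)

/-- `n_1 + ⋯ + n_d`. -/
def LocWord.weight {N : ℕ} (w : LocWord N) : ℤ := (w.1.map fun a => a.1).sum

/-- `n_1 + ⋯ + n_d`, for positive exponents. -/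
def HarWord.weight {N : ℕ} (w : HarWord N) : ℕ := (w.1.map fun a => (a.1 : ℕ)).sum

/-- `|n_1| + ⋯ + |n_d|`. -/
def LocWord.absWeight {N : ℕ} (w : LocWord N) : ℕ := (w.1.map fun a => a.1.natAbs).sum

section Sums

variable {N : ℕ} {K : Type*} [Field K]

/-- `ξ^j` for `j ∈ ℤ/Nℤ` (when `ξ^N = 1`). -/
def rootPow (ξ : K) (j : ZMod N) : K := ξ ^ j.val

/-- `∑_{0 < m_1 < ⋯ < m_d < m} ∏_i (ξ^{j_{i+1}} / ξ^{j_i})^{m_i} / m_i^{n_i}`,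
the last index `j_{d+1}` being the argument `k`. -/
def iterSum (ξ : K) : List (ℤ × ZMod N) → ZMod N → ℕ → K
  | [], _, _ => 1
  | (n, j) :: w, k, m =>
      ∑ y ∈ Finset.Ico 1 m, (rootPow ξ k / rootPow ξ j) ^ y / (y : K) ^ n * iterSum ξ w j y

/-- The localized multiple harmonic sum `𝔥_m(w)`. -/
def locSum (ξ : K) (m : ℕ) (w : LocWord N) : K :=
  iterSum ξ w.1 w.2 m * (1 / rootPow ξ w.2) ^ m

/-- The weighted localized multiple harmonic sum `har_m(w) = m^{n_1 + ⋯ + n_d} 𝔥_m(w)`;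
as a function of `w` this is the generating sequence `har_m^loc`. -/
def harLoc (ξ : K) (m : ℕ) (w : LocWord N) : K := (m : K) ^ w.weight * locSum ξ m w

/-- The (non-localized) generating sequence `har_m` of weighted multiple harmonic sums. -/
def har (ξ : K) (m : ℕ) (w : HarWord N) : K := harLoc ξ m w.toLoc

/-! ### The localization map for multiple harmonic sums -/

/-- For `ζ ≠ 1`, the polynomial `Q_l` with `ζ Q_l(X + 1) - Q_l(X) = X^l`. -/
noncomputable def twistedPoly (ζ : K) : ℕ → K[X]
  | l => C (ζ - 1)⁻¹ *
      (X ^ l - C ζ * ∑ i : Fin l, C ((l.choose i : ℕ) : K) * twistedPoly ζ i)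
  termination_by l => l
  decreasing_by exact i.isLt

/-- For `ζ = 1`, the polynomial `Q_l = ∑_δ (1/(l+1)) binom(l+1, δ) B_{l+1-δ} X^δ`
(`1 ≤ δ ≤ l + 1`) of Bernoulli and Faulhaber, with `Q_l(X + 1) - Q_l(X) = X^l`. -/
noncomputable def faulhaberPoly (K : Type*) [Field K] (l : ℕ) : K[X] :=
  ∑ i ∈ Finset.range (l + 1),
    C ((_root_.bernoulli i * ((l + 1).choose i : ℚ) / ((l : ℚ) + 1) : ℚ) : K) * X ^ (l + 1 - i)

open Classical in
/-- A polynomial `Q` such that `∑_{a ≤ u < b} ζ^u u^l = ζ^b Q(b) - ζ^a Q(a)`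
for all natural numbers `a ≤ b`. -/
noncomputable def powSumPoly (ζ : K) (l : ℕ) : K[X] :=
  if ζ = 1 then faulhaberPoly K l else twistedPoly ζ l

/-- Elements `∑ w ⊗ P_w` of (span of the non-localized words) `⊗ K[𝔪]`; such an element stands
for the function `x ↦ ∑ P_w(x) 𝔥_x(w)`. -/
abbrev WordComb (N : ℕ) (K : Type*) [Field K] := HarWord N →₀ K[X]

/-- `appendLetter ξ k w' n j` expresses
`x ↦ ∑_{0 < y < x} ξ^{k (y - x)} y^{-n} 𝔥_y(w'; j)`, for a non-localized word `(w'; j)`, through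
non-localized multiple harmonic sums.  If `n > 0` this is the sum of one word; if `n = -l ≤ 0`,
the sum over `y` is computed first, by means of `powSumPoly`: it runs over `0 < y < x` if `w'` is
empty, and over `z < y < x` if `z` is the largest variable of `w'`. -/
noncomputable def appendLetter (ξ : K) (k : ZMod N) :
    List (ℕ+ × ZMod N) → ℤ → ZMod N → WordComb N K
  | [], n, j =>
      if 0 < n then Finsupp.single ([(n.toNat.toPNat', j)], k) 1
      else
        let Q := powSumPoly (rootPow ξ (k - j)) (-n).toNat
        Finsupp.single ([], j) Q
          - Finsupp.single ([], k) (C ((Q + X ^ (-n).toNat).eval 0))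
  | (n', j') :: w, n, j =>
      if 0 < n then Finsupp.single ((n.toNat.toPNat', j) :: (n', j') :: w, k) 1
      else
        let Q := powSumPoly (rootPow ξ (k - j)) (-n).toNat
        Finsupp.single ((n', j') :: w, j) Q
          - (Q + X ^ (-n).toNat).sum fun δ a => C a • appendLetter ξ k w ((n' : ℤ) - δ) j'

/-- The localization map `loc^Σ`, from localized words to
(span of the non-localized words) `⊗ K[𝔪]`. -/
noncomputable def locSigma (ξ : K) : List (ℤ × ZMod N) → ZMod N → WordComb N K
  | [], k => Finsupp.single ([], k) 1
  | (n, j) :: w, k =>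
      (locSigma ξ w j).sum fun w' P =>
        P.sum fun δ a => C a • appendLetter ξ k w'.1 (n - δ) w'.2

/-- The dual `loc^∨` of `loc^Σ` at the integer `m`, in the weighted normalization: if `g` stands for
the weighted sums `har_m(w') = m^{weight w'} 𝔥_m(w')` of the non-localized words, then
`locDual ξ m g` stands for those of the localized words. -/
noncomputable def locDual (ξ : K) (m : ℕ) (g : HarWord N → K) (w : LocWord N) : K :=
  (m : K) ^ w.weight *
    (locSigma ξ w.1 w.2).sum fun w' P => P.eval (m : K) * ((m : K) ^ w'.weight)⁻¹ * g w'

/-! ### The harmonic action -/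

/-- Factor of a group `B` of residues `0 < r_a < ⋯ < r_b < p^α` with last index `k`; it is
`η^k g(B; k)` with `η = ξ^{p^α}`, and `1` for the empty group. -/
noncomputable def groupFactor (η : K) (g : LocWord N → K) (B : List (ℤ × ZMod N))
    (k : ZMod N) : K :=
  if B = [] then 1 else rootPow η k * g (B, k)

/-- The contribution of given binomial indices `l_i` to the expansion of a sum over
`0 < m_1 < ⋯ < m_d < p^α m` after the divisions `m_i = p^α u_i + r_i`, `0 ≤ r_i < p^α`.

The list of triples `(n_i, j_i, l_i)` is read from `i = d` down to `i = 1`.  Put `u_0 = r_0 = 0`.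
The condition `m_{i-1} < m_i` holds in exactly one of three ways:
* `r_i = 0` and `u_{i-1} < u_i`: then `m_i^{-n_i} = p^{-α n_i} u_i^{-n_i}` is not expanded;
* `r_i > 0` and `u_{i-1} < u_i`;
* `r_i > 0`, `u_{i-1} = u_i` and `r_{i-1} < r_i`;
in the last two cases `m_i^{-n_i}` is replaced by the term
`binom(-n_i, l_i) r_i^{-n_i-l_i} (p^α u_i)^{l_i}` of its binomial series.

State of the recursion: `B`, `k` are the letters `(n_i + l_i, j_i)` and the last index of the
residues `r_i > 0` that belong to the current value `u` of the quotients, `L` is the sum of their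
`l_i`, and `(out, k')` is the word in the larger values of the quotients.  At the end the current
value is `u = 0`, which contributes `0^L`.  The argument `g` replaces the weighted sums over the
residues, and `F` the sums over the quotients. -/
noncomputable def actTerm (η : K) (g F : LocWord N → K) (k' : ZMod N) :
    List (ℤ × ZMod N × ℕ) → ZMod N → List (ℤ × ZMod N) → ℕ → List (ℤ × ZMod N) → K
  | [], k, B, L, out => 0 ^ L * groupFactor η g B k * F (out, k')
  | (n, j, l) :: w, k, B, L, out =>
      0 ^ l * groupFactor η g B k * actTerm η g F k' w j [] 0 (out ++ [(n - (L : ℤ), j)])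
      + ((Ring.choose (-n) l : ℤ) : K) * groupFactor η g (B ++ [(n + (l : ℤ), j)]) k *
          actTerm η g F k' w j [] 0 (out ++ [(-((L : ℤ) + (l : ℤ)), j)])
      + ((Ring.choose (-n) l : ℤ) : K) *
          actTerm η g F k' w k (B ++ [(n + (l : ℤ), j)]) (L + l) out

/-- The word `w`, each letter being decorated by a binomial index. -/
def decorate (w : LocWord N) (l : Fin w.1.length → ℕ) : List (ℤ × ZMod N × ℕ) :=
  List.ofFn fun i => ((w.1.get i).1, (w.1.get i).2, l i)

/-- The term of index `(l_i)_i` of the coefficient of `w` at `m` in the action, localized at the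
source and at the target, of `g` on `f`.  Sums over residues with non-positive exponents are
expressed through the non-localized `g` by `loc^∨` at `p^α`. -/
noncomputable def actionTerm (p α : ℕ) (ξ : K) (g : HarWord N → K) (f : ℕ+ → LocWord N → K)
    (m : ℕ+) (w : LocWord N) (l : Fin w.1.length → ℕ) : K :=
  actTerm (ξ ^ p ^ α) (locDual ξ (p ^ α) g)
    (fun v => ((m : ℕ) : K) ^ (w.weight - v.weight) * f m v) w.2 (decorate w l) w.2 [] 0 []

/-- Pointwise application of `loc^∨`, with the root of unity `η`:
`Map(ℕ^*, functions on words) → Map(ℕ^*, functions on localized words)`. -/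
noncomputable def locDualMap (η : K) (f : ℕ+ → HarWord N → K) : ℕ+ → LocWord N → K :=
  fun m => locDual η m (f m)

end Sums

section Action

variable {N : ℕ} {K : Type*} [NormedField K]

/-- The `p`-adic pro-unipotent `Σ`-harmonic action localized at the source and at the target. -/
noncomputable def actionLocLoc (p α : ℕ) (ξ : K) (g : HarWord N → K)
    (f : ℕ+ → LocWord N → K) : ℕ+ → LocWord N → K :=
  fun m w => ∑' l : Fin w.1.length → ℕ, actionTerm p α ξ g f m w l

/-- The `p`-adic pro-unipotent `Σ`-harmonic action localized at the target: the previous one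
composed with `id × loc^∨`.  The second argument is a sequence of functions on the words in the
letters attached to the `p^α`-th powers of the roots of unity. -/
noncomputable def actionTarget (p α : ℕ) (ξ : K) (g : HarWord N → K)
    (f : ℕ+ → HarWord N → K) : ℕ+ → LocWord N → K :=
  actionLocLoc p α ξ g (locDualMap (ξ ^ p ^ α) f)

/-- Condition on the absolute values of the first argument: geometric decay with respect to the
weight, in each depth. -/
def IsSummableSeq (g : HarWord N → K) : Prop :=
  ∀ d : ℕ, ∃ C ρ : ℝ, 0 ≤ ρ ∧ ρ < 1 ∧
    ∀ w : HarWord N, w.1.length = d → ‖g w‖ ≤ C * ρ ^ w.weight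

/-- Condition on the absolute values of the second argument: for each `m`, each depth and each upper
bound on the exponents, the unweighted coefficients `m^{-weight w} f_m(w)` have at most polynomial
growth in the exponents. -/
def IsTempered (f : ℕ+ → LocWord N → K) : Prop :=
  ∀ (m : ℕ+) (d : ℕ) (c : ℤ), ∃ (C : ℝ) (e : ℕ),
    ∀ w : LocWord N, w.1.length = d → (∀ a ∈ w.1, a.1 ≤ c) →
      ‖f m w‖ ≤ C * (1 + (w.absWeight : ℝ)) ^ e * ‖((m : ℕ) : K)‖ ^ w.weight

end Action

end HarmonicAction

/-! Put `q = p ^ α`. A variable below `q m` is `q u + r` with `0 ≤ r < q`. If `r = 0`, its power is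
`q ^ (-n) * u ^ (-n)` exactly. If `r > 0`, then `‖q / r‖ ≤ 1 / p` (`norm_pow_div_le`), so `(q u + r)
^ (-n)` is a convergent binomial series in `q u / r`. Consecutive variables either share their
quotient or not. Summing over residues with a common quotient gives localized sums at `q`; summing
over the distinct quotients gives localized sums at `m`. `blockSum` is such a sum with some
variables already treated; `hasSum_blockSum` treats one more, producing the three branches of
`actTerm`, and `tsum_actTerm` iterates this. For multiple harmonic sums the identity is a
rearrangement of finite sums of convergent series, so the only analytic point is the exchange of
summations.

Eliminating nonpositive exponents is an identity between sums (`combEval_locSigma`), whence the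
statement on `loc^∨`. The analytic content is that this elimination costs little: the power-sum
polynomials have coefficients of norm at most `p (l + 1)`, because Bernoulli numbers are
`p`-adically bounded and `‖ζ - 1‖ = 1` for nontrivial `N`-th roots of unity. In bounded depth it
therefore costs a polynomial factor in the negative exponents and does not increase the positive
part of the weight (`exists_combNorm_locSigma_le`). This yields both temperedness of `loc^∨ f` and,
on exponents bounded below, geometric decay of `loc^∨ g`.

For summability, binomial coefficients are integers, hence of norm at most 1. Each unit of `l_i`
gains a factor `ρ < 1` from `g`, while the polynomial growth of `f` costs at most `s`, with `s > 1`
chosen so that `ρ s < 1` (`norm_actTerm_le`). -/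

namespace HarmonicAction

open Polynomial
open scoped ENNReal

/-! ### Norms of integers in an extension of the `p`-adic numbers -/

section PadicField

variable (p : ℕ) [Fact p.Prime] {K : Type*} [NormedField K] [NormedAlgebra ℚ_[p] K]

theorem norm_ratCast_eq (x : ℚ) : ‖(x : K)‖ = ‖(x : ℚ_[p])‖ := by
  rw [← norm_algebraMap' K (x : ℚ_[p]), map_ratCast]

theorem norm_natCast_eq (n : ℕ) : ‖(n : K)‖ = ‖(n : ℚ_[p])‖ := by
  simpa using norm_ratCast_eq p (K := K) n

include p in
theorem charZero_of_padic : CharZero K :=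
  charZero_of_injective_algebraMap (algebraMap ℚ_[p] K).injective

include p in
theorem isUltrametricDist_of_padic : IsUltrametricDist K :=
  IsUltrametricDist.isUltrametricDist_of_forall_norm_natCast_le_one fun n => by
    rw [norm_natCast_eq p]; exact IsUltrametricDist.norm_natCast_le_one _ n

theorem norm_prime_eq : ‖(p : K)‖ = (p : ℝ)⁻¹ := by
  rw [norm_natCast_eq p, Padic.norm_p]

include p in
theorem norm_natCast_inv_le {n : ℕ} (hn : n ≠ 0) : ‖(n : K)‖⁻¹ ≤ n := by
  rw [norm_natCast_eq p, Padic.norm_eq_zpow_neg_valuation (by exact_mod_cast hn),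
    Padic.valuation_natCast, zpow_neg, inv_inv, zpow_natCast]
  exact_mod_cast Nat.le_of_dvd (Nat.pos_of_ne_zero hn) pow_padicValNat_dvd

include p in
theorem norm_natCast_eq_one {n : ℕ} (hn : p.Coprime n) : ‖(n : K)‖ = 1 := by
  rw [norm_natCast_eq p]
  exact Padic.norm_natCast_eq_one_iff.2 hn

/-- A positive integer below `p ^ α` has `p`-adic valuation less than `α`. This gap gives both the
convergence of the binomial series and the decay of `har` at `p ^ α`. -/
theorem norm_pow_div_le {α r : ℕ} (hr : r ≠ 0) (hlt : r < p ^ α) :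
    ‖((p ^ α : ℕ) : K) / r‖ ≤ (p : ℝ)⁻¹ := by
  have hp : (0 : ℝ) < p := by exact_mod_cast (Fact.out : p.Prime).pos
  have hv : padicValNat p r < α := by
    by_contra h
    exact absurd (Nat.le_of_dvd (Nat.pos_of_ne_zero hr)
      ((pow_dvd_pow p (not_lt.1 h)).trans pow_padicValNat_dvd)) (not_le.2 hlt)
  obtain ⟨k, rfl⟩ := Nat.exists_eq_add_of_lt hv
  rw [norm_div, Nat.cast_pow, norm_pow, norm_prime_eq, norm_natCast_eq p,
    Padic.norm_eq_zpow_neg_valuation (by exact_mod_cast hr), Padic.valuation_natCast, zpow_neg,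
    zpow_natCast, div_inv_eq_mul, pow_succ, pow_add, inv_pow]
  have h1 : ((p : ℝ)⁻¹) ^ k ≤ 1 :=
    pow_le_one₀ (by positivity) (inv_le_one_of_one_le₀ (by exact_mod_cast (Fact.out : p.Prime).one_le))
  have h2 : ((p : ℝ) ^ padicValNat p r)⁻¹ * (p : ℝ) ^ padicValNat p r = 1 :=
    inv_mul_cancel₀ (by positivity)
  calc _ = (((p : ℝ) ^ padicValNat p r)⁻¹ * (p : ℝ) ^ padicValNat p r) * ((p : ℝ)⁻¹ ^ k * (p : ℝ)⁻¹) := by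
        ring
    _ ≤ _ := by
      rw [h2, one_mul]
      exact mul_le_of_le_one_left (by positivity) h1

end PadicField

/-! ### Ultrametric estimates and roots of unity of order prime to `p` -/

section Ultrametric

variable {K : Type*} [NormedField K] [IsUltrametricDist K]

theorem norm_sum_le_of_le {ι : Type*} (s : Finset ι) (f : ι → K) {C : ℝ} (hC : 0 ≤ C)
    (h : ∀ i ∈ s, ‖f i‖ ≤ C) : ‖∑ i ∈ s, f i‖ ≤ C :=
  IsUltrametricDist.norm_sum_le_of_forall_le_of_nonneg hC h

theorem norm_sub_le_of_le {a b : K} {C : ℝ} (ha : ‖a‖ ≤ C) (hb : ‖b‖ ≤ C) : ‖a - b‖ ≤ C := by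
  rw [sub_eq_add_neg]
  exact (IsUltrametricDist.norm_add_le_max _ _).trans (max_le ha (by rwa [norm_neg]))

omit [IsUltrametricDist K] in
theorem norm_of_pow_eq_one {N : ℕ} [NeZero N] {ζ : K} (h : ζ ^ N = 1) : ‖ζ‖ = 1 := by
  have : ‖ζ‖ ^ N = 1 := by rw [← norm_pow, h, norm_one]
  exact (pow_eq_one_iff_of_nonneg (norm_nonneg _) (NeZero.ne N)).1 this

/-- Since the powers of `ζ` sum to zero, `N = -∑ (ζ ^ i - 1)`, and every summand is `ζ - 1` times an
integral element; thus `‖N‖ = 1` forces `‖ζ - 1‖ ≥ 1`. -/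
theorem norm_sub_one_of_pow_eq_one {N : ℕ} [NeZero N] (hN : ‖(N : K)‖ = 1) {ζ : K} (h : ζ ^ N = 1)
    (h1 : ζ ≠ 1) : ‖ζ - 1‖ = 1 := by
  have hζ := norm_of_pow_eq_one h
  apply le_antisymm
  · exact norm_sub_le_of_le hζ.le (by simp)
  · have h0 : ∑ i ∈ Finset.range N, ζ ^ i = 0 := by
      rw [geom_sum_eq h1, h, sub_self, zero_div]
    have h2 : (N : K) = -∑ i ∈ Finset.range N, (ζ ^ i - 1) := by
      rw [Finset.sum_sub_distrib, h0]; simp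
    rw [← hN, h2, norm_neg]
    refine norm_sum_le_of_le _ _ (norm_nonneg _) fun i _ => ?_
    rw [← geom_sum_mul, norm_mul]
    refine mul_le_of_le_one_left (norm_nonneg _) (norm_sum_le_of_le _ _ zero_le_one fun j _ => ?_)
    simp [hζ]

end Ultrametric

/-! ### Boundedness of the Bernoulli numbers -/

section Bernoulli

variable (p : ℕ) [Fact p.Prime] {K : Type*} [NormedField K] [NormedAlgebra ℚ_[p] K]

include p in
-- The weak form of von Staudt–Clausen. Faulhaber's formula for `∑_{k < p} k ^ n` isolates `p B_n`;
-- the other terms are `p B_i` times an integer times `p ^ (n - i) / (n - i + 1)`, integral by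
-- induction and because `n - i + 1 ≤ p ^ (n - i)`.
theorem norm_bernoulli_le (n : ℕ) : ‖((_root_.bernoulli n : ℚ) : K)‖ ≤ p := by
  have := charZero_of_padic p (K := K)
  have := isUltrametricDist_of_padic p (K := K)
  have hp : (0 : ℝ) < p := by exact_mod_cast (Fact.out : p.Prime).pos
  have hp0 : (p : K) ≠ 0 := by exact_mod_cast (Fact.out : p.Prime).ne_zero
  induction n using Nat.strong_induction_on with
  | _ n ih =>
    have h := congrArg (fun x : ℚ => (x : K)) (sum_range_pow p n)
    rw [Finset.sum_range_succ] at h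
    push_cast at h
    have hn : ((n : K) + 1) ≠ 0 := by exact_mod_cast n.succ_ne_zero
    have h' : (p : K) * ((_root_.bernoulli n : ℚ) : K) = ∑ k ∈ Finset.range p, (k : K) ^ n
        - ∑ i ∈ Finset.range n, ((p : K) * (_root_.bernoulli i : ℚ)) * (n.choose i : K)
          * ((p : K) ^ (n - i) / ((n - i + 1 : ℕ) : K)) := by
      rw [h, eq_sub_iff_add_eq, add_comm]
      congr 1
      · refine Finset.sum_congr rfl fun i hi => ?_
        have hi' : i < n := Finset.mem_range.1 hi
        have hc : ((n + 1).choose i : K) * ((n - i + 1 : ℕ) : K) = (n.choose i : K) * (n + 1 : K) := by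
          have := Nat.choose_mul_succ_eq n i
          rw [Nat.succ_sub hi'.le] at this
          exact_mod_cast this.symm
        have h2 : ((n - i + 1 : ℕ) : K) ≠ 0 := by exact_mod_cast (n - i).succ_ne_zero
        rw [show n + 1 - i = (n - i) + 1 by omega, pow_succ]
        field_simp
        linear_combination (-(_root_.bernoulli i : ℚ) : K) * hc
      · rw [Nat.choose_succ_self_right, show n + 1 - n = 1 by omega]
        push_cast
        field_simp
    have h3 : ‖(p : K) * ((_root_.bernoulli n : ℚ) : K)‖ ≤ 1 := by
      rw [h']
      refine norm_sub_le_of_le ?_ ?_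
      · refine norm_sum_le_of_le _ _ zero_le_one fun k _ => ?_
        rw [norm_pow]
        exact pow_le_one₀ (norm_nonneg _) (IsUltrametricDist.norm_natCast_le_one K k)
      · refine norm_sum_le_of_le _ _ zero_le_one fun i hi => ?_
        have hi' : i < n := Finset.mem_range.1 hi
        rw [norm_mul, norm_mul, norm_mul, norm_div, norm_pow, norm_prime_eq p]
        have a1 : (p : ℝ)⁻¹ * ‖((_root_.bernoulli i : ℚ) : K)‖ ≤ 1 := by
          rw [inv_mul_le_iff₀ hp, mul_one]; exact ih i hi'
        have a2 := IsUltrametricDist.norm_natCast_le_one K (n.choose i)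
        have a3 : (p : ℝ)⁻¹ ^ (n - i) / ‖((n - i + 1 : ℕ) : K)‖ ≤ 1 := by
          have b1 := norm_natCast_inv_le p (K := K) (n - i).succ_ne_zero
          have b2 : ((n - i + 1 : ℕ) : ℝ) ≤ (p : ℝ) ^ (n - i) := by
            exact_mod_cast Nat.lt_pow_self (Fact.out : p.Prime).one_lt
          rw [div_eq_mul_inv, inv_pow, inv_mul_le_iff₀ (by positivity), mul_one]
          exact b1.trans b2
        exact mul_le_one₀ (mul_le_one₀ a1 (norm_nonneg _) a2) (by positivity) a3
    rw [norm_mul, norm_prime_eq, inv_mul_le_iff₀ hp, mul_one] at h3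
    exact h3

end Bernoulli

/-! ### Binomial series with integer exponent -/

section BinomialSeries

variable {K : Type*} [NormedField K]

/-- For `n ≥ 0` this is the finite binomial theorem. For `n = -(k + 1)`, the rule `binom(-(k+1), l)
= (-1)^l binom(k+l, k)` reduces it to the series of `1 / (1 - r) ^ (k + 1)` at `r = -x`. -/
theorem hasSum_choose_zpow (n : ℤ) {x : K} (hx : ‖x‖ < 1) :
    HasSum (fun l : ℕ => ((Ring.choose n l : ℤ) : K) * x ^ l) ((1 + x) ^ n) := by
  have hne : 1 + x ≠ 0 := by
    intro h
    have : x = -1 := by linear_combination h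
    simp [this] at hx
  rcases le_or_gt 0 n with h | h
  · obtain ⟨k, rfl⟩ := Int.eq_ofNat_of_zero_le h
    have he : (1 + x) ^ (k : ℤ) =
        ∑ l ∈ Finset.range (k + 1), ((Ring.choose (k : ℤ) l : ℤ) : K) * x ^ l := by
      rw [zpow_natCast, add_comm, add_pow]
      refine Finset.sum_congr rfl fun l _ => ?_
      rw [Ring.choose_natCast]
      simp [mul_comm]
    rw [he]
    have : ∀ l ∉ Finset.range (k + 1), ((Ring.choose (k : ℤ) l : ℤ) : K) * x ^ l = 0 := by
      intro l hl
      rw [Ring.choose_natCast, Nat.choose_eq_zero_of_lt (by simpa using hl)]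
      simp
    exact hasSum_sum_of_ne_finset_zero this
  · obtain ⟨k, rfl⟩ : ∃ k : ℕ, n = -((k : ℤ) + 1) := ⟨(-n - 1).toNat, by omega⟩
    have hs := hasSum_choose_mul_geometric_of_norm_lt_one k (r := -x) (by simpa using hx)
    convert! hs using 1
    · ext l
      rw [Ring.choose_neg, show ((k : ℤ) + 1 + l - 1) = ((k + l : ℕ) : ℤ) by push_cast; ring,
        Ring.choose_natCast, add_comm k l, Nat.choose_symm_add, neg_pow]
      simp only [Units.smul_def, Int.negOnePow_def]
      simp
      ring
    · rw [sub_neg_eq_add, zpow_neg, one_div]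
      norm_cast

end BinomialSeries

/-! ### Powers of a root of unity indexed by residues modulo `N` -/

section RootPow

variable {N : ℕ} [NeZero N] {K : Type*} [Field K] {ξ : K}

omit [NeZero N] in
theorem rootPow_pow_card (hξ : ξ ^ N = 1) (j : ZMod N) : rootPow ξ j ^ N = 1 := by
  rw [rootPow, ← pow_mul, mul_comm, pow_mul, hξ, one_pow]

theorem rootPow_ne_zero (hξ : ξ ^ N = 1) (j : ZMod N) : rootPow ξ j ≠ 0 := fun h => by
  have := rootPow_pow_card hξ j
  rw [h, zero_pow (NeZero.ne N)] at this
  exact zero_ne_one this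

theorem rootPow_add (hξ : ξ ^ N = 1) (i j : ZMod N) :
    rootPow ξ (i + j) = rootPow ξ i * rootPow ξ j := by
  rw [rootPow, rootPow, rootPow, ZMod.val_add, ← pow_add, ← pow_mod_orderOf ξ (i.val + j.val),
    ← pow_mod_orderOf, Nat.mod_mod_of_dvd _ (orderOf_dvd_of_pow_eq_one hξ)]

theorem rootPow_sub (hξ : ξ ^ N = 1) (i j : ZMod N) :
    rootPow ξ (i - j) = rootPow ξ i / rootPow ξ j := by
  rw [eq_div_iff (rootPow_ne_zero hξ j), ← rootPow_add hξ, sub_add_cancel]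

omit [NeZero N] in
theorem rootPow_pow (ξ : K) (q : ℕ) (j : ZMod N) : rootPow (ξ ^ q) j = rootPow ξ j ^ q := by
  rw [rootPow, rootPow, ← pow_mul, ← pow_mul, mul_comm]

end RootPow

/-! ### Closed formulas for twisted power sums -/

section PowSum

variable {K : Type*} [Field K]

theorem twistedPoly_eq (ζ : K) (l : ℕ) : twistedPoly ζ l = C (ζ - 1)⁻¹ *
      (X ^ l - C ζ * ∑ i ∈ Finset.range l, C ((l.choose i : ℕ) : K) * twistedPoly ζ i) := by
  rw [twistedPoly, Finset.sum_range]

/-- Take `ζ` times the recursion at `x + 1` minus the recursion at `x`. By induction the lower terms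
contribute `-ζ ((x + 1) ^ l - x ^ l)`, which leaves `(ζ - 1) x ^ l`. -/
theorem twistedPoly_eval {ζ : K} (hζ : ζ ≠ 1) (l : ℕ) (x : K) :
    ζ * (twistedPoly ζ l).eval (x + 1) - (twistedPoly ζ l).eval x = x ^ l := by
  have h1 : ζ - 1 ≠ 0 := sub_ne_zero.2 hζ
  have key : ∀ (l : ℕ) (x : K), (ζ - 1) * (twistedPoly ζ l).eval x =
      x ^ l - ζ * ∑ i ∈ Finset.range l, (l.choose i : K) * (twistedPoly ζ i).eval x := by
    intro l x
    rw [twistedPoly_eq, eval_mul, eval_C, mul_inv_cancel_left₀ h1]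
    simp [eval_finsetSum]
  induction l using Nat.strong_induction_on generalizing x with
  | _ l ih =>
    have hb : (x + 1) ^ l = ∑ i ∈ Finset.range l, (l.choose i : K) * x ^ i + x ^ l := by
      rw [add_pow, Finset.sum_range_succ]
      simp [mul_comm]
    have hs : ζ * ∑ i ∈ Finset.range l, (l.choose i : K) * (twistedPoly ζ i).eval (x + 1)
        - ∑ i ∈ Finset.range l, (l.choose i : K) * (twistedPoly ζ i).eval x
        = ∑ i ∈ Finset.range l, (l.choose i : K) * x ^ i := by
      rw [Finset.mul_sum, ← Finset.sum_sub_distrib]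
      refine Finset.sum_congr rfl fun i hi => ?_
      rw [← ih i (Finset.mem_range.1 hi) x]
      ring
    apply mul_left_cancel₀ h1
    linear_combination ζ * key l (x + 1) - key l x + ζ * hb - ζ * hs

theorem faulhaberPoly_eval_natCast [CharZero K] (l n : ℕ) :
    (faulhaberPoly K l).eval (n : K) = ∑ k ∈ Finset.range n, (k : K) ^ l := by
  have h := congrArg (fun x : ℚ => (x : K)) (sum_range_pow n l)
  push_cast at h
  rw [h, faulhaberPoly, eval_finsetSum]
  refine Finset.sum_congr rfl fun i _ => ?_
  simp only [eval_mul, eval_C, eval_pow, eval_X]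
  push_cast
  ring

theorem powSumPoly_eval_succ [CharZero K] (ζ : K) (l n : ℕ) :
    ζ * (powSumPoly ζ l).eval ((n : K) + 1) - (powSumPoly ζ l).eval (n : K) = (n : K) ^ l := by
  unfold powSumPoly
  split_ifs with h
  · have h1 := faulhaberPoly_eval_natCast (K := K) l (n + 1)
    rw [Finset.sum_range_succ, ← faulhaberPoly_eval_natCast] at h1
    push_cast at h1
    rw [h, h1]
    ring
  · exact twistedPoly_eval h l _

theorem sum_Ico_powSumPoly [CharZero K] (ζ : K) (l : ℕ) {a b : ℕ} (hab : a ≤ b) :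
    ∑ u ∈ Finset.Ico a b, ζ ^ u * (u : K) ^ l =
      ζ ^ b * (powSumPoly ζ l).eval (b : K) - ζ ^ a * (powSumPoly ζ l).eval (a : K) := by
  rw [← Finset.sum_Ico_sub (fun u : ℕ => ζ ^ u * (powSumPoly ζ l).eval (u : K)) hab]
  refine Finset.sum_congr rfl fun u _ => ?_
  rw [← powSumPoly_eval_succ ζ l u]
  push_cast
  ring

/-- The sum over `a < u < b`, the value at `a` being added to the polynomial. -/
theorem sum_Ico_succ_powSumPoly [CharZero K] (ζ : K) (l : ℕ) {a b : ℕ} (hab : a < b) :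
    ∑ u ∈ Finset.Ico (a + 1) b, ζ ^ u * (u : K) ^ l =
      ζ ^ b * (powSumPoly ζ l).eval (b : K) - ζ ^ a * (powSumPoly ζ l + X ^ l).eval (a : K) := by
  have h := sum_Ico_powSumPoly ζ l hab.le
  rw [Finset.sum_eq_sum_Ico_succ_bot hab] at h
  simp only [eval_add, eval_pow, eval_X]
  linear_combination h

theorem natDegree_twistedPoly_le (ζ : K) (l : ℕ) : (twistedPoly ζ l).natDegree ≤ l := by
  induction l using Nat.strong_induction_on with
  | _ l ih =>
    rw [twistedPoly_eq]
    refine (natDegree_C_mul_le _ _).trans ((natDegree_sub_le _ _).trans (max_le (natDegree_X_pow_le l) ?_))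
    refine (natDegree_C_mul_le _ _).trans (natDegree_sum_le_of_forall_le _ _ fun i hi => ?_)
    exact (natDegree_C_mul_le _ _).trans
      ((ih i (Finset.mem_range.1 hi)).trans (Finset.mem_range.1 hi).le)

theorem natDegree_powSumPoly_le (ζ : K) (l : ℕ) : (powSumPoly ζ l).natDegree ≤ l + 1 := by
  unfold powSumPoly
  split_ifs
  · refine natDegree_sum_le_of_forall_le _ _ fun i _ => ?_
    exact (natDegree_C_mul_le _ _).trans ((natDegree_X_pow_le _).trans (Nat.sub_le _ _))
  · exact (natDegree_twistedPoly_le ζ l).trans (Nat.le_succ l)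

end PowSum

/-! ### Coefficient bounds for the power-sum polynomials -/

section Norms

variable {K : Type*} [NormedField K]

theorem norm_coeff_twistedPoly_le [IsUltrametricDist K] {ζ : K} (h : ‖ζ‖ = 1) (h1 : ‖ζ - 1‖ = 1)
    (l i : ℕ) : ‖(twistedPoly ζ l).coeff i‖ ≤ 1 := by
  induction l using Nat.strong_induction_on with
  | _ l ih =>
    rw [twistedPoly_eq, coeff_C_mul, norm_mul, norm_inv, h1, inv_one, one_mul, coeff_sub]
    refine norm_sub_le_of_le ?_ ?_
    · rw [coeff_X_pow]
      split_ifs <;> simp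
    · rw [coeff_C_mul, norm_mul, h, one_mul, finsetSum_coeff]
      refine norm_sum_le_of_le _ _ zero_le_one fun j hj => ?_
      rw [coeff_C_mul, norm_mul]
      exact mul_le_one₀ (IsUltrametricDist.norm_natCast_le_one K _) (norm_nonneg _)
        (ih j (Finset.mem_range.1 hj))

variable (p : ℕ) [Fact p.Prime] [NormedAlgebra ℚ_[p] K]

include p in
theorem norm_coeff_faulhaberPoly_le (l i : ℕ) :
    ‖(faulhaberPoly K l).coeff i‖ ≤ (p : ℝ) * (l + 1) := by
  have := charZero_of_padic p (K := K)
  have := isUltrametricDist_of_padic p (K := K)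
  rw [faulhaberPoly, finsetSum_coeff]
  refine norm_sum_le_of_le _ _ (by positivity) fun j _ => ?_
  rw [coeff_C_mul, norm_mul, coeff_X_pow]
  have h1 : ‖(((_root_.bernoulli j * ((l + 1).choose j : ℚ) / ((l : ℚ) + 1) : ℚ)) : K)‖
      ≤ (p : ℝ) * (l + 1) := by
    push_cast
    rw [norm_div, norm_mul, div_eq_mul_inv]
    have a1 := norm_bernoulli_le p (K := K) j
    have a2 := IsUltrametricDist.norm_natCast_le_one K ((l + 1).choose j)
    have a3 := norm_natCast_inv_le p (K := K) l.succ_ne_zero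
    push_cast at a3
    calc _ ≤ ((p : ℝ) * 1) * (l + 1) := by gcongr
      _ = _ := by ring
  refine (mul_le_of_le_one_right (norm_nonneg _) ?_).trans h1
  split_ifs <;> simp

include p in
theorem norm_coeff_powSumPoly_le {N : ℕ} [NeZero N] (hpN : p.Coprime N) {ζ : K} (h : ζ ^ N = 1)
    (l i : ℕ) : ‖(powSumPoly ζ l).coeff i‖ ≤ (p : ℝ) * (l + 1) := by
  have := isUltrametricDist_of_padic p (K := K)
  unfold powSumPoly
  split_ifs with h1
  · exact norm_coeff_faulhaberPoly_le p l i
  · refine (norm_coeff_twistedPoly_le (norm_of_pow_eq_one h)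
      (norm_sub_one_of_pow_eq_one (norm_natCast_eq_one p hpN) h h1) l i).trans ?_
    have : (1 : ℝ) ≤ p := by exact_mod_cast (Fact.out : p.Prime).one_le
    have : (1 : ℝ) ≤ l + 1 := by exact_mod_cast Nat.succ_pos l
    nlinarith

end Norms

/-! ### Localization is an identity between multiple harmonic sums -/

section Evaluation

variable {N : ℕ} {K : Type*} [Field K]

/-- The value `∑ P_w(x) g(w)` of `∑ w ⊗ P_w`. -/
noncomputable def combEval (x : K) (g : HarWord N → K) : WordComb N K →ₗ[K] K :=
  Finsupp.lsum K fun w => (leval x).smulRight (g w)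

theorem combEval_apply (x : K) (g : HarWord N → K) (X : WordComb N K) :
    combEval x g X = X.sum fun w P => P.eval x * g w := by
  simp [combEval, Finsupp.sum, leval_apply]

@[simp]
theorem combEval_single (x : K) (g : HarWord N → K) (w : HarWord N) (P : K[X]) :
    combEval x g (Finsupp.single w P) = P.eval x * g w := by
  simp [combEval, leval_apply]

@[simp]
theorem combEval_C_smul (x : K) (g : HarWord N → K) (a : K) (X : WordComb N K) :
    combEval x g (C a • X) = a * combEval x g X := by
  have : (C a • X : WordComb N K) = a • X := by
    ext1 w
    simp [smul_eq_C_mul]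
  rw [this, map_smul, smul_eq_mul]

theorem combEval_polynomial_sum (x : K) (g : HarWord N → K) (P : K[X]) (F : ℕ → WordComb N K) :
    combEval x g (P.sum fun δ a => C a • F δ) = P.sum fun δ a => a * combEval x g (F δ) := by
  simp [Polynomial.sum, map_sum]

theorem locSum_cons (ξ : K) (x : ℕ) (n : ℤ) (j k : ZMod N) (w : List (ℤ × ZMod N)) :
    locSum ξ x ((n, j) :: w, k) = ∑ y ∈ Finset.Ico 1 x,
      rootPow ξ k ^ y / rootPow ξ k ^ x * (y : K) ^ (-n) * locSum ξ y (w, j) := by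
  rw [locSum, iterSum, Finset.sum_mul]
  refine Finset.sum_congr rfl fun y _ => ?_
  simp only [locSum, div_pow, one_pow, zpow_neg]
  ring

theorem locSum_nil (ξ : K) (x : ℕ) (k : ZMod N) :
    locSum ξ x (([] : List (ℤ × ZMod N)), k) = (rootPow ξ k ^ x)⁻¹ := by
  simp [locSum, iterSum]

/-- For `n ≤ 0`, exchange the sums so that `y` runs over `z < y < x` and apply the closed formula.
The endpoint `x` gives the word without the new letter; the endpoint `z` gives a polynomial in `z`,
which shifts the exponent of the next letter and leads back to the induction hypothesis. -/
theorem combEval_appendLetter [NeZero N] [CharZero K] {ξ : K} (hξ : ξ ^ N = 1) {x : ℕ} (hx : 0 < x)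
    (k : ZMod N) (w : List (ℕ+ × ZMod N)) (n : ℤ) (j : ZMod N) :
    combEval (x : K) (fun v => locSum ξ x v.toLoc) (appendLetter ξ k w n j) =
      ∑ y ∈ Finset.Ico 1 x, rootPow ξ k ^ y / rootPow ξ k ^ x * (y : K) ^ (-n) *
        locSum ξ y (HarWord.toLoc (w, j)) := by
  have hr := rootPow_ne_zero hξ
  induction w generalizing n j with
  | nil =>
    rw [appendLetter]
    split_ifs with hn
    · have h1 : ((n.toNat.toPNat' : ℕ) : ℤ) = n := by
        rw [Nat.toPNat'_coe, if_pos (by omega)]; omega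
      generalize n.toNat.toPNat' = u at h1 ⊢
      subst h1
      simp [HarWord.toLoc, locSum_cons]
    · obtain ⟨l, rfl⟩ : ∃ l : ℕ, n = -(l : ℤ) := ⟨(-n).toNat, by omega⟩
      -- With no smaller variable the lower endpoint is `0`, and the correction `X ^ l` removes the
      -- term `u = 0`, which is nonzero exactly when `l = 0`.
      have h := sum_Ico_succ_powSumPoly (rootPow ξ (k - j)) l hx
      simp only [neg_neg, Int.toNat_natCast, map_sub, combEval_single, eval_C, HarWord.toLoc,
        List.map_nil, locSum_nil, zpow_natCast, CharP.cast_eq_zero, zero_add, pow_zero, one_mul] at h ⊢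
      have h2 : ∑ y ∈ Finset.Ico 1 x, rootPow ξ k ^ y / rootPow ξ k ^ x * (y : K) ^ l *
          (rootPow ξ j ^ y)⁻¹ = (rootPow ξ k ^ x)⁻¹ *
            ∑ y ∈ Finset.Ico 1 x, rootPow ξ (k - j) ^ y * (y : K) ^ l := by
        rw [Finset.mul_sum]
        refine Finset.sum_congr rfl fun y _ => ?_
        rw [rootPow_sub hξ, div_pow]
        ring
      rw [h2, h, rootPow_sub hξ, div_pow]
      have := hr j
      have := hr k
      field_simp
  | cons a w ih =>
    obtain ⟨n', j'⟩ := a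
    rw [appendLetter]
    split_ifs with hn
    · have h1 : ((n.toNat.toPNat' : ℕ) : ℤ) = n := by
        rw [Nat.toPNat'_coe, if_pos (by omega)]; omega
      generalize n.toNat.toPNat' = u at h1 ⊢
      subst h1
      simp [HarWord.toLoc, locSum_cons]
    · obtain ⟨l, rfl⟩ : ∃ l : ℕ, n = -(l : ℤ) := ⟨(-n).toNat, by omega⟩
      simp only [neg_neg, Int.toNat_natCast, map_sub, combEval_single, combEval_polynomial_sum, ih,
        zpow_natCast]
      set ζ := rootPow ξ (k - j) with hζ
      set Q := powSumPoly ζ l with hQ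
      set H : ℕ → K := fun z => (z : K) ^ (-(n' : ℤ)) * locSum ξ z (HarWord.toLoc (w, j')) with hH
      have e1 : ∀ y : ℕ, locSum ξ y (HarWord.toLoc ((n', j') :: w, j)) =
          ∑ z ∈ Finset.Ico 1 y, rootPow ξ j ^ z / rootPow ξ j ^ y * H z := by
        intro y
        rw [HarWord.toLoc, List.map_cons, locSum_cons]
        refine Finset.sum_congr rfl fun z _ => ?_
        simp only [hH, HarWord.toLoc]
        ring
      -- Each monomial `z ^ δ` is absorbed into the exponent `n' - δ`; this is where `z ≠ 0` is
      -- needed.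
      have e2 : (Q + X ^ l).sum (fun δ a => a * ∑ y ∈ Finset.Ico 1 x, rootPow ξ k ^ y /
          rootPow ξ k ^ x * (y : K) ^ (-((n' : ℤ) - δ)) * locSum ξ y (HarWord.toLoc (w, j'))) =
          ∑ z ∈ Finset.Ico 1 x, rootPow ξ k ^ z / rootPow ξ k ^ x * (Q + X ^ l).eval (z : K) * H z := by
        simp only [Polynomial.sum, Finset.mul_sum, eval_eq_sum, Finset.sum_mul]
        rw [Finset.sum_comm]
        refine Finset.sum_congr rfl fun z hz => Finset.sum_congr rfl fun δ _ => ?_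
        have hz0 : (z : K) ≠ 0 := by
          have := (Finset.mem_Ico.1 hz).1
          exact_mod_cast (by omega : z ≠ 0)
        rw [neg_sub, sub_eq_add_neg, zpow_add₀ hz0, zpow_natCast]
        ring
      have e3 : ∑ y ∈ Finset.Ico 1 x, rootPow ξ k ^ y / rootPow ξ k ^ x * (y : K) ^ l *
          locSum ξ y (HarWord.toLoc ((n', j') :: w, j)) =
          ∑ z ∈ Finset.Ico 1 x, rootPow ξ j ^ z / rootPow ξ k ^ x * H z *
            ∑ y ∈ Finset.Ico (z + 1) x, ζ ^ y * (y : K) ^ l := by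
        simp only [e1, Finset.mul_sum]
        rw [Finset.sum_comm' (t' := Finset.Ico 1 x) (s' := fun z => Finset.Ico (z + 1) x)]
        · refine Finset.sum_congr rfl fun z _ => Finset.sum_congr rfl fun y _ => ?_
          rw [hζ, rootPow_sub hξ, div_pow]
          ring
        · intro y z
          simp only [Finset.mem_Ico]
          omega
      rw [e3, e2, e1, Finset.mul_sum, ← Finset.sum_sub_distrib]
      refine Finset.sum_congr rfl fun z hz => ?_
      rw [sum_Ico_succ_powSumPoly ζ l (Finset.mem_Ico.1 hz).2, ← hQ, hζ, rootPow_sub hξ, div_pow,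
        div_pow]
      have := hr j
      have := hr k
      field_simp

/-- Localizing the smaller variables first yields polynomials in the next variable `y`; their
monomials `y ^ δ` lower its exponent to `n - δ`, and `combEval_appendLetter` sums over `y`. -/
theorem combEval_locSigma [NeZero N] [CharZero K] {ξ : K} (hξ : ξ ^ N = 1) {x : ℕ} (hx : 0 < x)
    (w : List (ℤ × ZMod N)) (k : ZMod N) :
    combEval (x : K) (fun v => locSum ξ x v.toLoc) (locSigma ξ w k) = locSum ξ x (w, k) := by
  induction w generalizing k x with
  | nil => simp [locSigma, HarWord.toLoc]
  | cons a w ih =>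
    obtain ⟨n, j⟩ := a
    rw [locSigma, Finsupp.sum, map_sum, locSum_cons]
    simp only [combEval_polynomial_sum, combEval_appendLetter hξ hx]
    have : ∀ y ∈ Finset.Ico 1 x, locSum ξ y (w, j) = ∑ v ∈ (locSigma ξ w j).support,
        ((locSigma ξ w j) v).eval (y : K) * locSum ξ y v.toLoc := by
      intro y hy
      rw [← ih (Finset.mem_Ico.1 hy).1 j, combEval_apply, Finsupp.sum]
    refine Eq.trans ?_ (Finset.sum_congr rfl fun y hy => by rw [this y hy]).symm
    simp only [Finset.mul_sum]
    rw [Finset.sum_comm]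
    refine Finset.sum_congr rfl fun v _ => ?_
    simp only [Polynomial.sum, Finset.mul_sum, eval_eq_sum, Finset.sum_mul]
    rw [Finset.sum_comm]
    refine Finset.sum_congr rfl fun y hy => Finset.sum_congr rfl fun δ _ => ?_
    have hy0 : (y : K) ≠ 0 := by
      have := (Finset.mem_Ico.1 hy).1
      exact_mod_cast (by omega : y ≠ 0)
    rw [neg_sub, sub_eq_add_neg, zpow_add₀ hy0, zpow_natCast]
    ring

theorem HarWord.weight_toLoc (w : HarWord N) : w.toLoc.weight = w.weight := by
  simp [HarWord.toLoc, LocWord.weight, HarWord.weight, Function.comp_def]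

theorem locDual_eq_combEval (ξ : K) (m : ℕ) (g : HarWord N → K) (w : LocWord N) :
    locDual ξ m g w = (m : K) ^ w.weight *
      combEval (m : K) (fun v => ((m : K) ^ v.weight)⁻¹ * g v) (locSigma ξ w.1 w.2) := by
  simp only [locDual, combEval_apply, mul_assoc]

theorem locDual_har [NeZero N] [CharZero K] {ξ : K} (hξ : ξ ^ N = 1) {m : ℕ} (hm : 0 < m) :
    locDual (N := N) ξ m (har ξ m) = harLoc ξ m := by
  ext w
  have hm0 : (m : K) ≠ 0 := by exact_mod_cast hm.ne'
  have h : (fun v : HarWord N => ((m : K) ^ v.weight)⁻¹ * har ξ m v) =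
      fun v => locSum ξ m v.toLoc := by
    funext v
    simp only [har, harLoc]
    rw [HarWord.weight_toLoc, zpow_natCast, inv_mul_cancel_left₀ (pow_ne_zero _ hm0)]
  rw [locDual_eq_combEval, harLoc, ← combEval_locSigma hξ hm, h]

end Evaluation

/-! ### Weighted norms on combinations of words, with values in `ℝ≥0∞` so that no finiteness has to
be carried along -/

section CombNorm

variable {N : ℕ} {K : Type*} [NormedField K]

/-- The weighted `ℓ¹`-norm `∑ |a_{w,δ}| Ψ(w, δ)` of `∑ w ⊗ a_{w,δ} X^δ`. -/
noncomputable def combNorm (Ψ : HarWord N → ℕ → ℝ≥0∞) (X : WordComb N K) : ℝ≥0∞ :=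
  ∑' w, ∑' δ, ‖(X w).coeff δ‖ₑ * Ψ w δ

theorem combNorm_zero (Ψ : HarWord N → ℕ → ℝ≥0∞) : combNorm Ψ (0 : WordComb N K) = 0 := by
  simp [combNorm]

theorem combNorm_add_le (Ψ : HarWord N → ℕ → ℝ≥0∞) (X Y : WordComb N K) :
    combNorm Ψ (X + Y) ≤ combNorm Ψ X + combNorm Ψ Y := by
  unfold combNorm
  rw [← ENNReal.tsum_add]
  refine ENNReal.tsum_le_tsum fun w => ?_
  rw [← ENNReal.tsum_add]
  refine ENNReal.tsum_le_tsum fun δ => ?_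
  rw [← add_mul, Finsupp.add_apply, coeff_add]
  gcongr
  exact enorm_add_le _ _

theorem combNorm_neg (Ψ : HarWord N → ℕ → ℝ≥0∞) (X : WordComb N K) :
    combNorm Ψ (-X) = combNorm Ψ X := by
  simp [combNorm]

theorem combNorm_sub_le (Ψ : HarWord N → ℕ → ℝ≥0∞) (X Y : WordComb N K) :
    combNorm Ψ (X - Y) ≤ combNorm Ψ X + combNorm Ψ Y := by
  rw [sub_eq_add_neg, ← combNorm_neg Ψ Y]
  exact combNorm_add_le Ψ X (-Y)

theorem combNorm_sum_le {ι : Type*} (Ψ : HarWord N → ℕ → ℝ≥0∞) (s : Finset ι)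
    (F : ι → WordComb N K) : combNorm Ψ (∑ i ∈ s, F i) ≤ ∑ i ∈ s, combNorm Ψ (F i) :=
  Finset.le_sum_of_subadditive _ (combNorm_zero Ψ).le (combNorm_add_le Ψ) s F

theorem combNorm_C_smul (Ψ : HarWord N → ℕ → ℝ≥0∞) (a : K) (X : WordComb N K) :
    combNorm Ψ (C a • X) = ‖a‖ₑ * combNorm Ψ X := by
  simp only [combNorm, ← ENNReal.tsum_mul_left, Finsupp.smul_apply, smul_eq_mul, coeff_C_mul,
    enorm_mul, mul_assoc]

theorem combNorm_single (Ψ : HarWord N → ℕ → ℝ≥0∞) (w : HarWord N) (P : K[X]) :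
    combNorm Ψ (Finsupp.single w P) = ∑' δ, ‖P.coeff δ‖ₑ * Ψ w δ := by
  rw [combNorm, tsum_eq_single w]
  · simp
  · intro v hv
    simp [Finsupp.single_eq_of_ne hv]

theorem combNorm_single_C (Ψ : HarWord N → ℕ → ℝ≥0∞) (w : HarWord N) (a : K) :
    combNorm Ψ (Finsupp.single w (C a)) = ‖a‖ₑ * Ψ w 0 := by
  rw [combNorm_single, tsum_eq_single 0]
  · simp
  · intro v hv
    simp [coeff_C_of_ne_zero hv]

theorem combNorm_polynomial_sum_le (Ψ : HarWord N → ℕ → ℝ≥0∞) (P : K[X])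
    (F : ℕ → WordComb N K) :
    combNorm Ψ (P.sum fun δ a => C a • F δ) ≤ ∑' δ, ‖P.coeff δ‖ₑ * combNorm Ψ (F δ) := by
  refine (combNorm_sum_le Ψ _ _).trans ?_
  simp only [combNorm_C_smul]
  exact ENNReal.sum_le_tsum _

/-- Substitution pulls a weight back: the bounds for the substituted pieces become the new weight on
the source. This is what makes estimates for `locSigma` iterable. -/
theorem combNorm_bind_le (Ψ : HarWord N → ℕ → ℝ≥0∞) (X : WordComb N K)
    (F : HarWord N → ℕ → WordComb N K) :
    combNorm Ψ (X.sum fun w P => P.sum fun δ a => C a • F w δ) ≤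
      combNorm (fun w δ => combNorm Ψ (F w δ)) X :=
  (combNorm_sum_le Ψ _ _).trans <|
    (Finset.sum_le_sum fun _ _ => combNorm_polynomial_sum_le Ψ _ _).trans (ENNReal.sum_le_tsum _)

theorem enorm_combEval_le {x : K} (hx : ‖x‖ ≤ 1) (g : HarWord N → K) (X : WordComb N K) :
    ‖combEval x g X‖ₑ ≤ combNorm (fun w _ => ‖g w‖ₑ) X := by
  have hx' : ‖x‖ₑ ≤ 1 := by
    rwa [← ofReal_norm, ENNReal.ofReal_le_one]
  rw [combEval_apply]
  refine (enorm_sum_le _ _).trans (le_trans (Finset.sum_le_sum fun w _ => ?_)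
    (ENNReal.sum_le_tsum X.support))
  rw [enorm_mul, eval_eq_sum, Polynomial.sum, ENNReal.tsum_mul_right]
  gcongr
  refine (enorm_sum_le _ _).trans (le_trans (Finset.sum_le_sum fun δ _ => ?_)
    (ENNReal.sum_le_tsum (X w).support))
  rw [enorm_mul, enorm_pow]
  exact mul_le_of_le_one_right' (pow_le_one₀ zero_le hx')

theorem tsum_enorm_coeff_mul_le {P : K[X]} {D : ℕ} (hP : P.natDegree ≤ D) {c : ℝ≥0∞}
    (hc : ∀ i, ‖P.coeff i‖ₑ ≤ c) {φ : ℕ → ℝ≥0∞} {B : ℝ≥0∞} (hφ : ∀ δ ≤ D, φ δ ≤ B) :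
    ∑' δ, ‖P.coeff δ‖ₑ * φ δ ≤ (D + 1 : ℕ) * (c * B) := by
  rw [tsum_eq_sum (s := Finset.range (D + 1))]
  · refine (Finset.sum_le_card_nsmul _ _ (c * B) fun δ hδ => ?_).trans ?_
    · exact mul_le_mul' (hc δ) (hφ δ (by simpa [Nat.lt_succ_iff] using hδ))
    · simp
  · intro δ hδ
    rw [coeff_eq_zero_of_natDegree_lt (by simp at hδ; omega)]
    simp

end CombNorm

/-! ### Cost of appending one letter -/

section Bounds

variable (p : ℕ) [Fact p.Prime] {N : ℕ} [NeZero N] {K : Type*} [NormedField K]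
  [NormedAlgebra ℚ_[p] K]

include p in
theorem enorm_coeff_powSumPoly_le (hpN : p.Coprime N) {ζ : K} (h : ζ ^ N = 1) (l i : ℕ) :
    ‖(powSumPoly ζ l).coeff i‖ₑ ≤ (p * (l + 1) : ℕ) := by
  rw [← ofReal_norm, ENNReal.ofReal_le_natCast]
  exact_mod_cast norm_coeff_powSumPoly_le p hpN h l i

include p in
theorem enorm_coeff_powSumPoly_add_le (hpN : p.Coprime N) {ζ : K} (h : ζ ^ N = 1) (l i : ℕ) :
    ‖(powSumPoly ζ l + X ^ l).coeff i‖ₑ ≤ (p * (l + 1) : ℕ) := by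
  have := isUltrametricDist_of_padic p (K := K)
  rw [← ofReal_norm, ENNReal.ofReal_le_natCast, coeff_add]
  refine (IsUltrametricDist.norm_add_le_max _ _).trans (max_le ?_ ?_)
  · exact_mod_cast norm_coeff_powSumPoly_le p hpN h l i
  · have h1 : (1 : ℝ) ≤ (p * (l + 1) : ℕ) := by
      exact_mod_cast Nat.one_le_iff_ne_zero.2
        (Nat.mul_ne_zero (Fact.out : p.Prime).ne_zero l.succ_ne_zero)
    refine le_trans ?_ h1
    rw [coeff_X_pow]
    split_ifs <;> simp

omit [NeZero N] in
theorem natDegree_powSumPoly_add_le (ζ : K) (l : ℕ) :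
    (powSumPoly ζ l + X ^ l).natDegree ≤ l + 1 :=
  (natDegree_add_le _ _).trans
    (max_le (natDegree_powSumPoly_le ζ l) ((natDegree_X_pow_le l).trans (Nat.le_succ l)))

/-- Polynomial growth in the degree and geometric growth in the weight, on the words of bounded
depth and exponents. -/
def GrowthBound (Ψ : HarWord N → ℕ → ℝ≥0∞) (d : ℕ) (c : ℤ) (C R : ℝ≥0∞) (T e : ℕ) : Prop :=
  ∀ (v : HarWord N) (δ : ℕ), v.1.length ≤ d → (∀ a ∈ v.1, ((a.1 : ℕ) : ℤ) ≤ c) →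
    Ψ v δ ≤ C * ((T + δ : ℕ) : ℝ≥0∞) ^ e * R ^ v.weight

omit [NeZero N] in
theorem HarWord.weight_cons (a : ℕ+ × ZMod N) (w : List (ℕ+ × ZMod N)) (k j : ZMod N) :
    HarWord.weight (a :: w, k) = a.1 + HarWord.weight (w, j) := by
  simp [HarWord.weight]

/-- A nonpositive exponent `-l` brings a polynomial of degree at most `l + 1` with coefficients of
norm at most `p (l + 1)`: two powers of `T + l` for each letter crossed. The weight in `R` never
exceeds the sum of the positive exponents. -/
theorem combNorm_appendLetter_le (hpN : p.Coprime N) {ξ : K} (hξ : ξ ^ N = 1)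
    {Ψ : HarWord N → ℕ → ℝ≥0∞} {d : ℕ} {c : ℤ} {C R : ℝ≥0∞} {T e : ℕ} (hT : 1 ≤ T) (hR : 1 ≤ R)
    (hΨ : GrowthBound Ψ d c C R T e) (k : ZMod N) (w : List (ℕ+ × ZMod N)) (n : ℤ) (j : ZMod N)
    (hw : w.length < d) (hwc : ∀ a ∈ w, ((a.1 : ℕ) : ℤ) ≤ c) (hn : n ≤ c) :
    combNorm Ψ (appendLetter ξ k w n j) ≤
      C * ((2 * p * 2 ^ e + 2 * p : ℕ) : ℝ≥0∞) ^ (w.length + 1) *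
        ((T + (-n).toNat : ℕ) : ℝ≥0∞) ^ (e + 2 * (w.length + 1)) *
        R ^ (HarWord.weight (w, j) + n.toNat) := by
  have hp := (Fact.out : p.Prime).one_le
  -- The first summand pays for the endpoint `x`, with `2 ^ e` from `T + δ ≤ 2 (T + l)`; the second
  -- pays for the recursive endpoint `z`.
  set A : ℕ := 2 * p * 2 ^ e + 2 * p with hA
  have hA1 : (1 : ℝ≥0∞) ≤ A := by
    exact_mod_cast (by omega : 1 ≤ A)
  have pos_case : ∀ (w : List (ℕ+ × ZMod N)) (n : ℤ) (j : ZMod N), w.length < d →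
      (∀ a ∈ w, ((a.1 : ℕ) : ℤ) ≤ c) → n ≤ c → 0 < n →
      combNorm Ψ (Finsupp.single ((n.toNat.toPNat', j) :: w, k) (1 : K[X])) ≤
      C * (A : ℝ≥0∞) ^ (w.length + 1) *
        ((T + (-n).toNat : ℕ) : ℝ≥0∞) ^ (e + 2 * (w.length + 1)) *
        R ^ (HarWord.weight (w, j) + n.toNat) := by
    intro w n j hw hwc hn h0
    have h1 : (n.toNat.toPNat' : ℕ) = n.toNat := by
      rw [Nat.toPNat'_coe, if_pos (by omega)]
    rw [← C_1, combNorm_single_C, enorm_one, one_mul]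
    refine (hΨ _ _ (by simpa using hw) ?_).trans ?_
    · intro a ha
      rcases List.mem_cons.1 ha with rfl | ha
      · rw [h1]; omega
      · exact hwc a ha
    · rw [HarWord.weight_cons _ _ _ j, h1, add_comm n.toNat]
      have h2 : ((T + 0 : ℕ) : ℝ≥0∞) ^ e ≤
          ((T + (-n).toNat : ℕ) : ℝ≥0∞) ^ (e + 2 * (w.length + 1)) := by
        norm_cast
        exact (Nat.pow_le_pow_left (by omega) e).trans (Nat.pow_le_pow_right (by omega) (by omega))
      gcongr
      exact le_mul_of_one_le_right' (one_le_pow_of_one_le' hA1 _)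
  have first_term : ∀ (w : List (ℕ+ × ZMod N)) (l : ℕ) (j : ZMod N), w.length < d →
      (∀ a ∈ w, ((a.1 : ℕ) : ℤ) ≤ c) →
      combNorm Ψ (Finsupp.single (w, j) (powSumPoly (rootPow ξ (k - j)) l)) ≤
      C * ((2 * p * 2 ^ e : ℕ) : ℝ≥0∞) * ((T + l : ℕ) : ℝ≥0∞) ^ (e + 2) *
        R ^ HarWord.weight (w, j) := by
    intro w l j hw hwc
    rw [combNorm_single]
    refine (tsum_enorm_coeff_mul_le (natDegree_powSumPoly_le _ l)
      (enorm_coeff_powSumPoly_le p hpN (rootPow_pow_card hξ _) l)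
      (B := C * ((2 * (T + l) : ℕ) : ℝ≥0∞) ^ e * R ^ HarWord.weight (w, j)) ?_).trans ?_
    · intro δ hδ
      refine (hΨ _ _ (by simpa using hw.le) hwc).trans ?_
      gcongr
      omega
    · have h2 : (((l + 1 + 1 : ℕ) : ℝ≥0∞) * ((p * (l + 1) : ℕ) : ℝ≥0∞)) * ((2 * (T + l) : ℕ) : ℝ≥0∞) ^ e ≤
          ((2 * p * 2 ^ e : ℕ) : ℝ≥0∞) * ((T + l : ℕ) : ℝ≥0∞) ^ (e + 2) := by
        norm_cast
        calc (l + 1 + 1) * (p * (l + 1)) * (2 * (T + l)) ^ e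
            ≤ (2 * (T + l)) * (p * (T + l)) * (2 * (T + l)) ^ e :=
              Nat.mul_le_mul_right _
                (Nat.mul_le_mul (by omega) (Nat.mul_le_mul_left _ (by omega)))
          _ = _ := by rw [mul_pow]; ring
      calc _ = C * ((((l + 1 + 1 : ℕ) : ℝ≥0∞) * ((p * (l + 1) : ℕ) : ℝ≥0∞)) *
            ((2 * (T + l) : ℕ) : ℝ≥0∞) ^ e) * R ^ HarWord.weight (w, j) := by ring
        _ ≤ C * (((2 * p * 2 ^ e : ℕ) : ℝ≥0∞) * ((T + l : ℕ) : ℝ≥0∞) ^ (e + 2)) *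
            R ^ HarWord.weight (w, j) := by gcongr
        _ = _ := by ring
  have hsq : ∀ l : ℕ, (((l + 1 + 1 : ℕ) : ℝ≥0∞) * ((p * (l + 1) : ℕ) : ℝ≥0∞)) ≤
      ((2 * p : ℕ) : ℝ≥0∞) * ((T + l : ℕ) : ℝ≥0∞) ^ 2 := by
    intro l
    norm_cast
    calc (l + 1 + 1) * (p * (l + 1)) ≤ (2 * (T + l)) * (p * (T + l)) :=
          Nat.mul_le_mul (by omega) (Nat.mul_le_mul_left _ (by omega))
      _ = _ := by ring
  induction w generalizing n j with
  | nil =>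
    rw [appendLetter]
    split_ifs with h0
    · exact pos_case [] n j hw hwc hn h0
    · obtain ⟨l, rfl⟩ : ∃ l : ℕ, n = -(l : ℤ) := ⟨(-n).toNat, by omega⟩
      simp only [neg_neg, Int.toNat_natCast]
      refine (combNorm_sub_le _ _ _).trans ((add_le_add (first_term [] l j hw hwc) (b := _)
        (d := C * ((2 * p : ℕ) : ℝ≥0∞) * ((T + l : ℕ) : ℝ≥0∞) ^ (e + 2) * 1) ?_).trans ?_)
      · rw [combNorm_single_C, ← coeff_zero_eq_eval_zero]
        refine (mul_le_mul' (enorm_coeff_powSumPoly_add_le p hpN (rootPow_pow_card hξ _) l 0)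
          (hΨ _ 0 (by simp) (by simp))).trans ?_
        have h2 : ((p * (l + 1) : ℕ) : ℝ≥0∞) * ((T + 0 : ℕ) : ℝ≥0∞) ^ e ≤
            ((2 * p : ℕ) : ℝ≥0∞) * ((T + l : ℕ) : ℝ≥0∞) ^ (e + 2) := by
          norm_cast
          calc p * (l + 1) * (T + 0) ^ e ≤ (p * (T + l)) * (T + l) ^ e :=
                Nat.mul_le_mul (Nat.mul_le_mul_left _ (by omega)) (Nat.pow_le_pow_left (by omega) e)
            _ = p * (T + l) ^ (e + 1) := by ring
            _ ≤ (2 * p) * (T + l) ^ (e + 2) :=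
              Nat.mul_le_mul (by omega) (Nat.pow_le_pow_right (by omega) (by omega))
        calc _ = C * (((p * (l + 1) : ℕ) : ℝ≥0∞) * ((T + 0 : ℕ) : ℝ≥0∞) ^ e) := by
              simp [HarWord.weight]; ring
          _ ≤ C * (((2 * p : ℕ) : ℝ≥0∞) * ((T + l : ℕ) : ℝ≥0∞) ^ (e + 2)) := by gcongr
          _ = _ := by ring
      · apply le_of_eq
        simp [HarWord.weight, hA]
        ring
  | cons a w ih =>
    obtain ⟨n', j'⟩ := a
    have hw' : w.length < d := by simp at hw; omega
    have hwc' : ∀ a ∈ w, ((a.1 : ℕ) : ℤ) ≤ c := fun a ha => hwc a (List.mem_cons_of_mem _ ha)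
    have hn' : ((n' : ℕ) : ℤ) ≤ c := hwc (n', j') List.mem_cons_self
    rw [appendLetter]
    split_ifs with h0
    · exact pos_case _ n j hw hwc hn h0
    · obtain ⟨l, rfl⟩ : ∃ l : ℕ, n = -(l : ℤ) := ⟨(-n).toNat, by omega⟩
      simp only [neg_neg, Int.toNat_natCast]
      set B : ℝ≥0∞ := C * (A : ℝ≥0∞) ^ (w.length + 1) *
        ((T + l : ℕ) : ℝ≥0∞) ^ (e + 2 * (w.length + 1)) * R ^ HarWord.weight ((n', j') :: w, j)
        with hB
      refine (combNorm_sub_le _ _ _).trans ((add_le_add (first_term _ l j hw hwc) (b := _)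
        (d := ((2 * p : ℕ) : ℝ≥0∞) * ((T + l : ℕ) : ℝ≥0∞) ^ 2 * B) ?_).trans ?_)
      · refine (combNorm_polynomial_sum_le _ _ _).trans ((tsum_enorm_coeff_mul_le
          (natDegree_powSumPoly_add_le _ l)
          (enorm_coeff_powSumPoly_add_le p hpN (rootPow_pow_card hξ _) l) (B := B) ?_).trans ?_)
        · intro δ hδ
          refine (ih _ _ hw' hwc' (by omega)).trans ?_
          rw [HarWord.weight_cons _ _ _ j', add_comm (n' : ℕ)] at hB
          rw [hB]
          -- Although `δ` may reach `l + 1`, the bound `n' ≥ 1` keeps the new negative exponent at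
          -- most `l`.
          have h1 : ((T + (-((n' : ℤ) - δ)).toNat : ℕ) : ℝ≥0∞) ≤ ((T + l : ℕ) : ℝ≥0∞) := by
            have := n'.pos
            exact Nat.cast_le.2 (by omega)
          have h2 : HarWord.weight (w, j') + ((n' : ℤ) - δ).toNat ≤
              HarWord.weight (w, j') + n' := by omega
          exact mul_le_mul' (mul_le_mul' le_rfl (pow_le_pow_left' h1 _)) (pow_le_pow_right' hR h2)
        · rw [← mul_assoc]
          exact mul_le_mul' (hsq l) le_rfl
      · have h3 : ((T + l : ℕ) : ℝ≥0∞) ^ (e + 2) ≤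
            ((T + l : ℕ) : ℝ≥0∞) ^ (e + 2 * (w.length + 1 + 1)) := by
          norm_cast
          exact Nat.pow_le_pow_right (by omega) (by omega)
        have h4 : ((2 * p * 2 ^ e : ℕ) : ℝ≥0∞) ≤
            ((2 * p * 2 ^ e : ℕ) : ℝ≥0∞) * (A : ℝ≥0∞) ^ (w.length + 1) :=
          le_mul_of_one_le_right' (one_le_pow_of_one_le' hA1 _)
        simp only [List.length_cons, Int.toNat_neg_natCast, add_zero]
        calc _ ≤ C * (((2 * p * 2 ^ e : ℕ) : ℝ≥0∞) * (A : ℝ≥0∞) ^ (w.length + 1)) *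
              ((T + l : ℕ) : ℝ≥0∞) ^ (e + 2 * (w.length + 1 + 1)) *
                R ^ HarWord.weight ((n', j') :: w, j) + _ := by gcongr
          _ = C * (((2 * p * 2 ^ e : ℕ) : ℝ≥0∞) + ((2 * p : ℕ) : ℝ≥0∞)) *
              (A : ℝ≥0∞) ^ (w.length + 1) * ((T + l : ℕ) : ℝ≥0∞) ^ (e + 2 * (w.length + 1 + 1)) *
                R ^ HarWord.weight ((n', j') :: w, j) := by rw [hB]; ring
          _ = _ := by rw [← Nat.cast_add, ← hA]; ring

end Bounds

/-! ### Bounds for the localization map and its dual -/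

section LocBounds

variable (p : ℕ) [Fact p.Prime] {N : ℕ} [NeZero N] {K : Type*} [NormedField K]
  [NormedAlgebra ℚ_[p] K]

include p in
-- The induction on depth replaces `Ψ` by the weight `combNorm Ψ (appendLetter ...)`, which
-- satisfies a growth bound with larger parameters. Hence `A` and `e'` must depend on `d` and `e`
-- but not on `Ψ`, `c`, `C`, `R` or `T`.
theorem exists_combNorm_locSigma_le (hpN : p.Coprime N) {ξ : K} (hξ : ξ ^ N = 1) (d e : ℕ) :
    ∃ A e' : ℕ, 1 ≤ A ∧ e ≤ e' ∧ ∀ (Ψ : HarWord N → ℕ → ℝ≥0∞) (c : ℤ) (C R : ℝ≥0∞) (T : ℕ),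
      1 ≤ T → 1 ≤ R → GrowthBound Ψ d c C R T e →
      ∀ (w : List (ℤ × ZMod N)) (k : ZMod N), w.length ≤ d → (∀ a ∈ w, a.1 ≤ c) →
        combNorm Ψ (locSigma ξ w k) ≤ C * A *
          ((T + (w.map fun a => (-a.1).toNat).sum : ℕ) : ℝ≥0∞) ^ e' *
            R ^ (w.map fun a => a.1.toNat).sum := by
  have nil_case : ∀ (d e A e' : ℕ), 1 ≤ A → e ≤ e' → ∀ (Ψ : HarWord N → ℕ → ℝ≥0∞) (c : ℤ)
      (C R : ℝ≥0∞) (T : ℕ), 1 ≤ T → GrowthBound Ψ d c C R T e → ∀ k : ZMod N,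
        combNorm Ψ (locSigma ξ [] k) ≤ C * A * ((T + 0 : ℕ) : ℝ≥0∞) ^ e' * R ^ 0 := by
    intro d e A e' hA he Ψ c C R T hT hΨ k
    rw [locSigma, ← C_1, combNorm_single_C, enorm_one, one_mul]
    refine (hΨ _ 0 (by simp) (by simp)).trans ?_
    have h1 : ((T + 0 : ℕ) : ℝ≥0∞) ^ e ≤ ((T + 0 : ℕ) : ℝ≥0∞) ^ e' := by
      norm_cast
      exact Nat.pow_le_pow_right (by omega) he
    simp only [HarWord.weight, List.map_nil, List.sum_nil]
    gcongr
    exact le_mul_of_one_le_right' (by exact_mod_cast hA)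
  induction d generalizing e with
  | zero =>
    refine ⟨1, e, le_rfl, le_rfl, fun Ψ c C R T hT hR hΨ w k hw hwc => ?_⟩
    obtain rfl := List.length_eq_zero_iff.1 (Nat.le_zero.1 hw)
    exact nil_case 0 e 1 e le_rfl le_rfl Ψ c C R T hT hΨ k
  | succ d ih =>
    obtain ⟨A, e', hA, he, h⟩ := ih (e + 2 * (d + 1))
    set A' : ℕ := 2 * p * 2 ^ e + 2 * p with hA'
    have hA1 : 1 ≤ A' := by
      have := (Fact.out : p.Prime).one_le
      omega
    refine ⟨A' ^ (d + 1) * A, e', Nat.one_le_iff_ne_zero.2 (Nat.mul_ne_zero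
      (pow_ne_zero _ (by omega)) (by omega)), by omega,
      fun Ψ c C R T hT hR hΨ w k hw hwc => ?_⟩
    cases w with
    | nil =>
      exact nil_case _ e _ e' (Nat.one_le_iff_ne_zero.2 (Nat.mul_ne_zero
        (pow_ne_zero _ (by omega)) (by omega))) (by omega) Ψ c C R T hT hΨ k
    | cons a w =>
      obtain ⟨n, j⟩ := a
      have hn : n ≤ c := hwc (n, j) List.mem_cons_self
      rw [locSigma]
      -- The new letter moves its positive part into the constant, as `R ^ n.toNat`, and its
      -- negative part into `T`.
      refine (combNorm_bind_le _ _ _).trans ((h _ c (C * (A' : ℝ≥0∞) ^ (d + 1) * R ^ n.toNat) R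
        (T + (-n).toNat) (by omega) hR ?_ w j (by simpa using hw)
          fun a ha => hwc a (List.mem_cons_of_mem _ ha)).trans (le_of_eq ?_))
      · intro v δ hv hvc
        refine (combNorm_appendLetter_le p hpN hξ hT hR hΨ k v.1 (n - δ) v.2 (by omega) hvc
          (by omega)).trans ?_
        have h1 : ((T + (-(n - (δ : ℤ))).toNat : ℕ) : ℝ≥0∞) ≤ ((T + (-n).toNat + δ : ℕ) : ℝ≥0∞) :=
          Nat.cast_le.2 (by omega)
        have h2 : (1 : ℝ≥0∞) ≤ ((T + (-n).toNat + δ : ℕ) : ℝ≥0∞) := by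
          exact_mod_cast (by omega : 1 ≤ T + (-n).toNat + δ)
        have h3 : HarWord.weight v + (n - (δ : ℤ)).toNat ≤ n.toNat + HarWord.weight v := by omega
        calc _ ≤ C * (A' : ℝ≥0∞) ^ (d + 1) *
              ((T + (-n).toNat + δ : ℕ) : ℝ≥0∞) ^ (e + 2 * (d + 1)) *
              R ^ (n.toNat + HarWord.weight v) := by
              refine mul_le_mul' (mul_le_mul' (mul_le_mul' le_rfl
                (pow_le_pow_right' (by exact_mod_cast hA1) (by omega))) ?_)
                (pow_le_pow_right' hR h3)
              exact (pow_le_pow_left' h1 _).trans (pow_le_pow_right' h2 (by omega))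
          _ = _ := by rw [pow_add R]; ring
      · simp only [List.map_cons, List.sum_cons, ← add_assoc]
        rw [pow_add R]
        push_cast
        ring

omit [NeZero N] in
theorem LocWord.sum_toNat_neg_le_absWeight (w : LocWord N) :
    (w.1.map fun a => (-a.1).toNat).sum ≤ w.absWeight :=
  List.sum_le_sum fun a _ => by omega

omit [NeZero N] in
theorem LocWord.sum_toNat (w : LocWord N) :
    (((w.1.map fun a => a.1.toNat).sum : ℕ) : ℤ) =
      w.weight + ((w.1.map fun a => (-a.1).toNat).sum : ℕ) := by
  obtain ⟨w, k⟩ := w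
  simp only [LocWord.weight]
  induction w with
  | nil => simp
  | cons a w ih =>
    simp only [List.map_cons, List.sum_cons]
    push_cast at ih ⊢
    rw [ih]
    omega

theorem finite_harWord_of_le (d : ℕ) (c : ℤ) :
    {v : HarWord N | v.1.length ≤ d ∧ ∀ a ∈ v.1, ((a.1 : ℕ) : ℤ) ≤ c}.Finite := by
  have hfin : {a : ℕ+ × ZMod N | ((a.1 : ℕ) : ℤ) ≤ c}.Finite := by
    have : {n : ℕ+ | ((n : ℕ) : ℤ) ≤ c}.Finite :=
      (Set.finite_Iic c.toNat).preimage (f := fun n : ℕ+ => (n : ℕ))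
        (fun a _ b _ h => PNat.coe_injective h) |>.subset fun n (hn : ((n : ℕ) : ℤ) ≤ c) => by
          simp only [Set.mem_preimage, Set.mem_Iic]; omega
    exact (this.prod (Set.finite_univ (α := ZMod N))).subset fun a ha => ⟨ha, trivial⟩
  have := hfin.to_subtype
  refine ((((List.finite_length_le {a : ℕ+ × ZMod N | ((a.1 : ℕ) : ℤ) ≤ c} d).image
    (List.map Subtype.val)).prod (Set.finite_univ (α := ZMod N)))).subset ?_
  rintro ⟨v, k⟩ ⟨h1, h2⟩
  refine ⟨⟨v.attachWith (· ∈ {a : ℕ+ × ZMod N | ((a.1 : ℕ) : ℤ) ≤ c}) h2, ?_, ?_⟩, trivial⟩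
  · exact (List.length_attachWith ..).trans_le h1
  · exact List.attachWith_map_subtype_val ..

include p in
-- With depth and exponents bounded above, only finitely many non-localized words can occur, so the
-- unweighted values of `f m` on them are bounded. The general estimate with `R = 1` then leaves
-- polynomial growth only.
theorem isTempered_locDualMap (hpN : p.Coprime N) {η : K} (hη : η ^ N = 1)
    (f : ℕ+ → HarWord N → K) : IsTempered (locDualMap η f) := by
  have := charZero_of_padic p (K := K)
  have := isUltrametricDist_of_padic p (K := K)
  intro m d c
  obtain ⟨A, e, -, -, h⟩ := exists_combNorm_locSigma_le p hpN hη d 0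
  set g : HarWord N → K := fun v => ((((m : ℕ) : K)) ^ v.weight)⁻¹ * f m v with hg
  obtain ⟨B, hB⟩ := ((finite_harWord_of_le (N := N) d c).image fun v => ‖g v‖₊).bddAbove
  have hB0 : (0 : ℝ) ≤ B := B.2
  refine ⟨B * A, e, fun w hw hwc => ?_⟩
  have hb := h (fun v _ => ‖g v‖ₑ) c (ENNReal.ofReal B) 1 1 le_rfl le_rfl (fun v δ hv hvc => by
    simp only [pow_zero, mul_one, one_pow]
    rw [← ofReal_norm]
    exact ENNReal.ofReal_le_ofReal (hB ⟨v, ⟨hv, hvc⟩, rfl⟩)) w.1 w.2 hw.le hwc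
  have hb' := (enorm_combEval_le (IsUltrametricDist.norm_natCast_le_one K (m : ℕ)) g
    (locSigma η w.1 w.2)).trans hb
  rw [one_pow, mul_one, ← ofReal_norm, ← ENNReal.ofReal_natCast, ← ENNReal.ofReal_natCast,
    ← ENNReal.ofReal_pow (by positivity), ← ENNReal.ofReal_mul hB0,
    ← ENNReal.ofReal_mul (by positivity), ENNReal.ofReal_le_ofReal_iff (by positivity)] at hb'
  rw [locDualMap, locDual_eq_combEval, norm_mul, norm_zpow, mul_comm]
  refine mul_le_mul_of_nonneg_right ?_ (by positivity)
  have hle : ((1 + (w.1.map fun a => (-a.1).toNat).sum : ℕ) : ℝ) ≤ 1 + (w.absWeight : ℝ) := by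
    have := LocWord.sum_toNat_neg_le_absWeight w
    exact_mod_cast (by omega)
  refine hb'.trans ?_
  gcongr

omit [NeZero N] [NormedAlgebra ℚ_[p] K] [Fact p.Prime] in
-- The lower bound `r ≤ ρ` is imposed so that `ρ / ‖p ^ α‖ ≥ 1` in `exists_norm_locDual_le`.
theorem IsSummableSeq.exists_uniform {g : HarWord N → K} (hg : IsSummableSeq g) {r : ℝ}
    (hr0 : 0 < r) (hr1 : r < 1) (d : ℕ) :
    ∃ C ρ : ℝ, 0 ≤ C ∧ r ≤ ρ ∧ ρ < 1 ∧
      ∀ w : HarWord N, w.1.length ≤ d → ‖g w‖ ≤ C * ρ ^ w.weight := by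
  have mono : ∀ (C ρ C' ρ' : ℝ), 0 ≤ ρ → C ≤ C' → 0 ≤ C' → ρ ≤ ρ' → ∀ w : HarWord N,
      ‖g w‖ ≤ C * ρ ^ w.weight → ‖g w‖ ≤ C' * ρ' ^ w.weight := by
    intro C ρ C' ρ' h1 h2 h3 h4 w h
    exact h.trans (mul_le_mul h2 (pow_le_pow_left₀ h1 h4 _) (by positivity) h3)
  induction d with
  | zero =>
    obtain ⟨C, ρ, h0, h1, h⟩ := hg 0
    exact ⟨max C 0, max ρ r, le_max_right _ _, le_max_right _ _, max_lt h1 hr1, fun w hw =>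
      mono _ _ _ _ h0 (le_max_left _ _) (le_max_right _ _) (le_max_left _ _) w
        (h w (Nat.le_zero.1 hw))⟩
  | succ d ih =>
    obtain ⟨C', ρ', hC', hr', h1', h'⟩ := ih
    obtain ⟨C, ρ, h0, h1, h⟩ := hg (d + 1)
    refine ⟨max C C', max ρ ρ', hC'.trans (le_max_right _ _), hr'.trans (le_max_right _ _),
      max_lt h1 h1', fun w hw => ?_⟩
    rcases Nat.lt_or_ge d w.1.length with hd | hd
    · exact mono _ _ _ _ h0 (le_max_left _ _) (hC'.trans (le_max_right _ _)) (le_max_left _ _) w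
        (h w (by omega))
    · exact mono _ _ _ _ (hr0.le.trans hr') (le_max_right _ _) (hC'.trans (le_max_right _ _))
        (le_max_right _ _) w (h' w hd)

include p in
-- Removing the weight from `g` turns the ratio `ρ` into `R = ρ / ‖p ^ α‖ ≥ 1`. Restoring it brings
-- back `ρ ^ weight`, up to powers of the total negative part, which is at most `d * c`.
theorem exists_norm_locDual_le (hpN : p.Coprime N) {ξ : K} (hξ : ξ ^ N = 1) {α : ℕ} (hα : 0 < α)
    {g : HarWord N → K} (hg : IsSummableSeq g) (d c : ℕ) :
    ∃ C ρ : ℝ, 0 ≤ C ∧ 0 < ρ ∧ ρ < 1 ∧ ∀ w : LocWord N, w.1.length ≤ d →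
      (∀ a ∈ w.1, -(c : ℤ) ≤ a.1) → ‖locDual ξ (p ^ α) g w‖ ≤ C * ρ ^ w.weight := by
  have := charZero_of_padic p (K := K)
  have := isUltrametricDist_of_padic p (K := K)
  set q : K := ((p ^ α : ℕ) : K) with hq
  have hp1 : (1 : ℝ) < p := by exact_mod_cast (Fact.out : p.Prime).one_lt
  have hqn : ‖q‖ = (p : ℝ)⁻¹ ^ α := by rw [hq, Nat.cast_pow, norm_pow, norm_prime_eq]
  have hq0 : 0 < ‖q‖ := by rw [hqn]; positivity
  have hq1 : ‖q‖ < 1 := by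
    rw [hqn]
    exact pow_lt_one₀ (by positivity) (inv_lt_one_of_one_lt₀ hp1) hα.ne'
  obtain ⟨C, ρ, hC, hρ, hρ1, h⟩ := hg.exists_uniform hq0 hq1 d
  have hρ0 : 0 < ρ := hq0.trans_le hρ
  obtain ⟨A, e, -, -, hA⟩ := exists_combNorm_locSigma_le p hpN hξ d 0
  set R : ℝ := ρ / ‖q‖ with hR
  have hR1 : 1 ≤ R := (one_le_div hq0).2 hρ
  set S : ℝ := C * A * ((1 + d * c : ℕ) : ℝ) ^ e * R ^ (d * c) with hS
  refine ⟨S, ρ, by positivity, hρ0, hρ1, fun w hw hwc => ?_⟩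
  set G : HarWord N → K := fun v => (q ^ v.weight)⁻¹ * g v with hG
  have hGb : ∀ v : HarWord N, v.1.length ≤ d → ‖G v‖ ≤ C * R ^ v.weight := by
    intro v hv
    rw [hG, norm_mul, norm_inv, norm_pow, hR, div_pow, inv_mul_eq_div, ← mul_div_assoc]
    gcongr
    exact h v hv
  -- The bound on `G` holds for all exponents, so any upper bound for those of `w` will do; their
  -- positive sum is a convenient one.
  have hmax : ∀ a ∈ w.1, a.1 ≤ ((w.1.map fun a => a.1.toNat).sum : ℕ) := by
    intro a ha
    have := List.single_le_sum (l := w.1.map fun a => a.1.toNat) (by simp) a.1.toNat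
      (List.mem_map.2 ⟨a, ha, rfl⟩)
    omega
  have hb := (enorm_combEval_le hq1.le G (locSigma ξ w.1 w.2)).trans
    (hA (fun v _ => ‖G v‖ₑ) _ (ENNReal.ofReal C) (ENNReal.ofReal R) 1 le_rfl
      (by rwa [ENNReal.one_le_ofReal]) (fun v δ hv _ => by
        simp only [pow_zero, mul_one]
        rw [← ofReal_norm, ← ENNReal.ofReal_pow (by positivity),
          ← ENNReal.ofReal_mul hC]
        exact ENNReal.ofReal_le_ofReal (hGb v hv)) w.1 w.2 hw hmax)
  set s := (w.1.map fun a => (-a.1).toNat).sum with hs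
  have hsle : s ≤ d * c := by
    have h1 := List.sum_le_card_nsmul (w.1.map fun a => (-a.1).toNat) c (by
      intro x hx
      obtain ⟨a, ha, rfl⟩ := List.mem_map.1 hx
      have := hwc a ha
      omega)
    rw [List.length_map, smul_eq_mul] at h1
    exact h1.trans (Nat.mul_le_mul_right _ hw)
  have hb' : ‖combEval q G (locSigma ξ w.1 w.2)‖ ≤ C * A * ((1 + s : ℕ) : ℝ) ^ e *
      R ^ (w.1.map fun a => a.1.toNat).sum := by
    rw [← ofReal_norm, ← ENNReal.ofReal_pow (by positivity), ← ENNReal.ofReal_natCast,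
      ← ENNReal.ofReal_natCast, ← ENNReal.ofReal_pow (by positivity), ← ENNReal.ofReal_mul hC,
      ← ENNReal.ofReal_mul (by positivity), ← ENNReal.ofReal_mul (by positivity),
      ENNReal.ofReal_le_ofReal_iff (by positivity)] at hb
    exact hb
  have hpow : R ^ (w.1.map fun a => a.1.toNat).sum = R ^ s * R ^ w.weight := by
    rw [← zpow_natCast, ← zpow_natCast, ← zpow_add₀ (by positivity), LocWord.sum_toNat, add_comm]
  rw [locDual_eq_combEval, norm_mul, norm_zpow, mul_comm]
  calc _ ≤ (C * A * ((1 + s : ℕ) : ℝ) ^ e * (R ^ s * R ^ w.weight)) * ‖q‖ ^ w.weight := by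
        rw [← hpow]
        gcongr
    _ ≤ (C * A * ((1 + d * c : ℕ) : ℝ) ^ e * (R ^ (d * c) * R ^ w.weight)) * ‖q‖ ^ w.weight := by
        have : R ^ s ≤ R ^ (d * c) := pow_le_pow_right₀ hR1 hsle
        have : ((1 + s : ℕ) : ℝ) ≤ ((1 + d * c : ℕ) : ℝ) := by exact_mod_cast (by omega)
        gcongr
    _ = S * ρ ^ w.weight := by
        have : ρ ^ w.weight = R ^ w.weight * ‖q‖ ^ w.weight := by
          rw [← mul_zpow, hR, div_mul_cancel₀ _ hq0.ne']
        rw [this, hS]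
        ring

end LocBounds

/-! ### Decay of the multiple harmonic sums at `p ^ α` -/

section HarBound

variable (p : ℕ) [Fact p.Prime] {N : ℕ} [NeZero N] {K : Type*} [NormedField K]
  [NormedAlgebra ℚ_[p] K]

theorem norm_rootPow {ξ : K} (hξ : ξ ^ N = 1) (j : ZMod N) : ‖rootPow ξ j‖ = 1 :=
  norm_of_pow_eq_one (rootPow_pow_card hξ j)

/-- Distribute the weight over the letters: every factor `(p ^ α / y) ^ n` has norm at most `p ^
(-n)`. -/
theorem norm_pow_mul_iterSum_le {ξ : K} (hξ : ξ ^ N = 1) {α m : ℕ} (hm : m ≤ p ^ α)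
    (w : List (ℕ+ × ZMod N)) (k : ZMod N) :
    ‖((p ^ α : ℕ) : K) ^ HarWord.weight (w, k) *
      iterSum ξ (w.map fun a => ((a.1 : ℤ), a.2)) k m‖ ≤ (p : ℝ)⁻¹ ^ HarWord.weight (w, k) := by
  have := isUltrametricDist_of_padic p (K := K)
  induction w generalizing k m with
  | nil => simp [HarWord.weight, iterSum]
  | cons a w ih =>
    obtain ⟨n, j⟩ := a
    rw [List.map_cons, iterSum, HarWord.weight_cons _ _ _ j, Finset.mul_sum]
    refine norm_sum_le_of_le _ _ (by positivity) fun y hy => ?_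
    obtain ⟨hy1, hy2⟩ := Finset.mem_Ico.1 hy
    have h1 : ((p ^ α : ℕ) : K) ^ ((n : ℕ) + HarWord.weight (w, j)) *
        ((rootPow ξ k / rootPow ξ j) ^ y / (y : K) ^ ((n : ℕ) : ℤ) *
          iterSum ξ (w.map fun a => ((a.1 : ℤ), a.2)) j y) =
        (rootPow ξ k / rootPow ξ j) ^ y * (((p ^ α : ℕ) : K) / y) ^ (n : ℕ) *
          (((p ^ α : ℕ) : K) ^ HarWord.weight (w, j) *
            iterSum ξ (w.map fun a => ((a.1 : ℤ), a.2)) j y) := by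
      rw [zpow_natCast, div_pow _ (y : K), pow_add]
      ring
    rw [h1, norm_mul, norm_mul, norm_pow, norm_div, norm_rootPow hξ, norm_rootPow hξ, div_one,
      one_pow, one_mul, norm_pow, pow_add]
    exact mul_le_mul (pow_le_pow_left₀ (norm_nonneg _)
      (norm_pow_div_le p (by omega) (hy2.trans_le hm)) _) (ih (by omega) j) (norm_nonneg _)
      (by positivity)

include p in
theorem isSummableSeq_har {ξ : K} (hξ : ξ ^ N = 1) (α : ℕ) :
    IsSummableSeq (har (N := N) ξ (p ^ α)) := by
  intro d
  refine ⟨1, (p : ℝ)⁻¹, by positivity,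
    inv_lt_one_of_one_lt₀ (by exact_mod_cast (Fact.out : p.Prime).one_lt), fun w _ => ?_⟩
  simp only [har, harLoc, locSum]
  rw [← mul_assoc, norm_mul, norm_pow, norm_div, norm_rootPow hξ, norm_one, div_one, one_pow,
    mul_one, one_mul, HarWord.weight_toLoc, zpow_natCast]
  exact norm_pow_mul_iterSum_le p hξ le_rfl w.1 w.2

end HarBound

/-! ### Summability of the harmonic action -/

section ActTerm

variable {N : ℕ} {K : Type*} [NormedField K]

theorem LocWord.weight_append (u v : List (ℤ × ZMod N)) (k : ZMod N) :
    LocWord.weight (u ++ v, k) = LocWord.weight (u, k) + LocWord.weight (v, k) := by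
  simp [LocWord.weight]

theorem LocWord.absWeight_append (u v : List (ℤ × ZMod N)) (k : ZMod N) :
    LocWord.absWeight (u ++ v, k) = LocWord.absWeight (u, k) + LocWord.absWeight (v, k) := by
  simp [LocWord.absWeight]

/-- An expanded residue gains `ρ ^ l` through its exponent `n + l`, and its `l` later enters one
exponent of `out`, at cost `s ^ l`. The factor `s ^ L` reserves the cost of indices not yet placed
in `out`. Each letter costs at most `C * (s / ρ) ^ c` for its own exponent, times 3 for the
branches; `C ^ 2` bounds the terminal values of `g` and `F`. -/
theorem norm_actTerm_le [IsUltrametricDist K] {η : K} {g F : LocWord N → K} {k' : ZMod N}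
    {d c : ℕ} {C ρ s : ℝ} (hC : 1 ≤ C) (hρ0 : 0 < ρ) (hρ1 : ρ < 1) (hs : 1 ≤ s)
    (hg : ∀ (B : List (ℤ × ZMod N)) (k : ZMod N), B.length ≤ d → (∀ a ∈ B, -(c : ℤ) ≤ a.1) →
      ‖groupFactor η g B k‖ ≤ C * ρ ^ LocWord.weight (B, k))
    (hF : ∀ out : List (ℤ × ZMod N), out.length ≤ d → (∀ a ∈ out, a.1 ≤ c) →
      ‖F (out, k')‖ ≤ C * s ^ LocWord.absWeight (out, k'))
    (w : List (ℤ × ZMod N × ℕ)) (hw : ∀ a ∈ w, a.1.natAbs ≤ c) (k : ZMod N)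
    (B : List (ℤ × ZMod N)) (L : ℕ) (out : List (ℤ × ZMod N))
    (hBd : B.length + w.length ≤ d) (hBc : ∀ a ∈ B, -(c : ℤ) ≤ a.1)
    (hod : out.length + w.length ≤ d) (hoc : ∀ a ∈ out, a.1 ≤ c) :
    ‖actTerm η g F k' w k B L out‖ ≤ C ^ 2 * (3 * C * (s / ρ) ^ c) ^ w.length *
      ρ ^ LocWord.weight (B, k) * s ^ (LocWord.absWeight (out, k') + L) *
        (ρ * s) ^ (w.map fun a => a.2.2).sum := by
  have hC0 : 0 < C := one_pos.trans_le hC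
  have hs0 : 0 < s := one_pos.trans_le hs
  -- The unexpanded branch lives on `l = 0` only, so it obeys the same geometric bound.
  have h0τ : ∀ l : ℕ, ‖(0 : K) ^ l‖ ≤ (ρ * s) ^ l := by
    intro l
    rcases l with _ | l
    · simp
    · simp; positivity
  have hchoose : ∀ (n : ℤ) (l : ℕ), ‖((Ring.choose n l : ℤ) : K)‖ ≤ 1 := fun n l =>
    IsUltrametricDist.norm_intCast_le_one K _
  induction w generalizing k B L out with
  | nil =>
    rw [actTerm, norm_mul, norm_mul]
    have h1 : ‖(0 : K) ^ L‖ ≤ s ^ L := by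
      rcases L with _ | L
      · simp
      · simp; positivity
    have h2 := hg B k (by simpa using hBd) hBc
    have h3 := hF out (by simpa using hod) hoc
    calc _ ≤ s ^ L * (C * ρ ^ LocWord.weight (B, k)) * (C * s ^ LocWord.absWeight (out, k')) := by
          gcongr
      _ = _ := by simp; ring
  | cons a w ih =>
    obtain ⟨n, j, l⟩ := a
    have hn : n.natAbs ≤ c := hw (n, j, l) List.mem_cons_self
    have hw' : ∀ a ∈ w, a.1.natAbs ≤ c := fun a ha => hw a (List.mem_cons_of_mem _ ha)
    have hlen : ((n, j, l) :: w).length = w.length + 1 := rfl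
    rw [hlen] at hBd hod
    set S := (w.map fun a => a.2.2).sum with hS
    set E := 3 * C * (s / ρ) ^ c with hE
    set b := LocWord.weight (B, k) with hb
    set o := LocWord.absWeight (out, k') with ho
    have hBc' : ∀ a ∈ B ++ [(n + (l : ℤ), j)], -(c : ℤ) ≤ a.1 := by
      intro a ha
      rcases List.mem_append.1 ha with ha | ha
      · exact hBc a ha
      · rw [List.mem_singleton.1 ha]
        simp only
        omega
    have hout : ∀ t : ℤ, t ≤ c → ∀ a ∈ out ++ [(t, j)], a.1 ≤ c := by
      intro t ht a ha
      rcases List.mem_append.1 ha with ha | ha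
      · exact hoc a ha
      · rw [List.mem_singleton.1 ha]
        exact ht
    have hwB : LocWord.weight (B ++ [(n + (l : ℤ), j)], k) = b + n + l := by
      rw [LocWord.weight_append, hb]
      simp [LocWord.weight, add_assoc]
    have hao : ∀ t : ℤ, LocWord.absWeight (out ++ [(t, j)], k') = o + t.natAbs := by
      intro t
      rw [LocWord.absWeight_append, ho]
      simp [LocWord.absWeight]
    have hρn : ρ ^ n * s ^ c ≤ (s / ρ) ^ c := by
      rw [div_pow, div_eq_mul_inv, mul_comm]
      gcongr
      rw [← zpow_natCast, ← zpow_neg]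
      exact zpow_le_zpow_right_of_le_one₀ hρ0 hρ1.le (by omega)
    have hρn' : ρ ^ n ≤ (s / ρ) ^ c :=
      (le_mul_of_one_le_right (by positivity) (one_le_pow₀ hs)).trans hρn
    have hsc : s ^ c ≤ (s / ρ) ^ c :=
      pow_le_pow_left₀ hs0.le ((le_div_iff₀ hρ0).2 (mul_le_of_le_one_right hs0.le hρ1.le)) c
    have hpos : 0 < C ^ 2 * E ^ w.length * ρ ^ b * s ^ (o + L) * (ρ * s) ^ (l + S) := by positivity
    set Z := C ^ 2 * E ^ w.length * ρ ^ b * s ^ (o + L) * (ρ * s) ^ (l + S) with hZ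
    have hD : ‖0 ^ l * groupFactor η g B k *
        actTerm η g F k' w j [] 0 (out ++ [(n - (L : ℤ), j)])‖ ≤ C * (s / ρ) ^ c * Z := by
      rw [norm_mul, norm_mul]
      have h1 := ih hw' j [] 0 (out ++ [(n - (L : ℤ), j)]) (by simp; omega) (by simp)
        (by simp; omega) (hout _ (by omega))
      rw [hao] at h1
      have h2 : s ^ (o + (n - (L : ℤ)).natAbs + 0) ≤ s ^ (o + L) * (s / ρ) ^ c := by
        refine le_trans ?_ (mul_le_mul_of_nonneg_left hsc (by positivity))
        rw [← pow_add]
        exact pow_le_pow_right₀ hs (by omega)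
      calc _ ≤ (ρ * s) ^ l * (C * ρ ^ b) * (C ^ 2 * E ^ w.length * 1 *
            (s ^ (o + L) * (s / ρ) ^ c) * (ρ * s) ^ S) := by
            refine mul_le_mul (mul_le_mul (h0τ l) (hg B k (by omega) hBc) (norm_nonneg _)
              (by positivity)) (h1.trans ?_) (norm_nonneg _) (by positivity)
            have : LocWord.weight (([] : List (ℤ × ZMod N)), j) = 0 := by simp [LocWord.weight]
            rw [this, zpow_zero]
            gcongr
        _ = _ := by rw [hZ, pow_add (ρ * s)]; ring
    have hS' : ‖((Ring.choose (-n) l : ℤ) : K) * groupFactor η g (B ++ [(n + (l : ℤ), j)]) k *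
          actTerm η g F k' w j [] 0 (out ++ [(-((L : ℤ) + (l : ℤ)), j)])‖ ≤
        C * (s / ρ) ^ c * Z := by
      rw [norm_mul, norm_mul]
      have h1 := ih hw' j [] 0 (out ++ [(-((L : ℤ) + (l : ℤ)), j)]) (by simp; omega) (by simp)
        (by simp; omega) (hout _ (by omega))
      have h2 := hg (B ++ [(n + (l : ℤ), j)]) k (by simp; omega) hBc'
      rw [hwB, zpow_add₀ hρ0.ne', zpow_add₀ hρ0.ne', zpow_natCast] at h2
      rw [hao, show o + (-((L : ℤ) + (l : ℤ))).natAbs + 0 = o + L + l by omega] at h1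
      have : LocWord.weight (([] : List (ℤ × ZMod N)), j) = 0 := by simp [LocWord.weight]
      rw [this, zpow_zero] at h1
      calc _ ≤ 1 * (C * (ρ ^ b * ρ ^ n * ρ ^ l)) * (C ^ 2 * E ^ w.length * 1 *
            s ^ (o + L + l) * (ρ * s) ^ S) := by
            exact mul_le_mul (mul_le_mul (hchoose _ _) h2 (norm_nonneg _) (by positivity)) h1
              (norm_nonneg _) (by positivity)
        _ = C * ρ ^ n * Z := by rw [hZ, pow_add (ρ * s), pow_add s (o + L), mul_pow]; ring
        _ ≤ _ := by gcongr
    have hCC : ‖((Ring.choose (-n) l : ℤ) : K) *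
          actTerm η g F k' w k (B ++ [(n + (l : ℤ), j)]) (L + l) out‖ ≤
        C * (s / ρ) ^ c * Z := by
      rw [norm_mul]
      have h1 := ih hw' k (B ++ [(n + (l : ℤ), j)]) (L + l) out (by simp; omega) hBc'
        (by omega) hoc
      rw [hwB, zpow_add₀ hρ0.ne', zpow_add₀ hρ0.ne', zpow_natCast, ← add_assoc] at h1
      calc _ ≤ 1 * (C ^ 2 * E ^ w.length * (ρ ^ b * ρ ^ n * ρ ^ l) * s ^ (o + L + l) *
              (ρ * s) ^ S) := by
            exact mul_le_mul (hchoose _ _) h1 (norm_nonneg _) zero_le_one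
        _ = 1 * ρ ^ n * Z := by rw [hZ, pow_add (ρ * s), pow_add s (o + L), mul_pow]; ring
        _ ≤ _ := by gcongr
    rw [actTerm]
    refine (norm_add₃_le ..).trans ((add_le_add (add_le_add hD hS') hCC).trans (le_of_eq ?_))
    simp only [List.length_cons, List.map_cons, List.sum_cons]
    rw [hZ, pow_succ E, hE]
    ring

theorem summable_pow_sum {τ : ℝ} (h0 : 0 ≤ τ) (h1 : τ < 1) (d : ℕ) :
    Summable fun l : Fin d → ℕ => τ ^ ∑ i, l i := by
  induction d with
  | zero => exact Summable.of_finite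
  | succ d ih =>
    rw [← (Fin.consEquiv fun _ => ℕ).summable_iff]
    refine ((summable_geometric_of_lt_one h0 h1).mul_of_nonneg ih (fun _ => by positivity)
      (fun _ => by positivity)).congr fun x => ?_
    simp [Fin.consEquiv, Fin.sum_univ_succ, pow_add]

theorem exists_pow_le_const_mul_pow (e : ℕ) {s : ℝ} (hs : 1 < s) :
    ∃ D : ℝ, 0 ≤ D ∧ ∀ a : ℕ, (1 + (a : ℝ)) ^ e ≤ D * s ^ a := by
  obtain ⟨D, hD⟩ := (tendsto_pow_const_div_const_pow_of_one_lt e hs).bddAbove_range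
  have hs0 : 0 < s := one_pos.trans hs
  have hb : ∀ a : ℕ, (1 + (a : ℝ)) ^ e ≤ (D * s) * s ^ a := by
    intro a
    have h := hD ⟨a + 1, rfl⟩
    simp only at h
    rw [div_le_iff₀ (by positivity)] at h
    push_cast at h
    rw [add_comm]
    refine h.trans (le_of_eq ?_)
    ring
  refine ⟨D * s, ?_, hb⟩
  have := hb 0
  simp at this
  linarith

theorem sum_map_decorate (w : LocWord N) (l : Fin w.1.length → ℕ) :
    ((decorate w l).map fun a => a.2.2).sum = ∑ i, l i := by
  simp [decorate, List.map_ofFn, List.sum_ofFn, Function.comp_def]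

theorem mem_of_mem_decorate {w : LocWord N} {l : Fin w.1.length → ℕ} {a : ℤ × ZMod N × ℕ}
    (ha : a ∈ decorate w l) : (a.1, a.2.1) ∈ w.1 := by
  obtain ⟨i, rfl⟩ := (List.mem_ofFn' _ _).1 ha
  exact List.get_mem _ _

/-- Comparison with `∑ (ρ s) ^ (∑ l_i)`. Every state of the recursion is covered, since
`tsum_actTerm` exchanges summations at each step. -/
theorem summable_actTerm (p : ℕ) [Fact p.Prime] [NeZero N] [NormedAlgebra ℚ_[p] K]
    [CompleteSpace K] (hpN : p.Coprime N) {ξ : K} (hξ : ξ ^ N = 1) {α : ℕ} (hα : 0 < α)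
    {g : HarWord N → K} {f : ℕ+ → LocWord N → K} (hg : IsSummableSeq g) (hf : IsTempered f)
    (m : ℕ+) (W : ℤ) (k' : ZMod N) (d c : ℕ) (w : List (ℤ × ZMod N)) (hw : ∀ a ∈ w, a.1.natAbs ≤ c)
    (k : ZMod N) (B : List (ℤ × ZMod N)) (L : ℕ) (out : List (ℤ × ZMod N))
    (hBd : B.length + w.length ≤ d) (hBc : ∀ a ∈ B, -(c : ℤ) ≤ a.1)
    (hod : out.length + w.length ≤ d) (hoc : ∀ a ∈ out, a.1 ≤ c) :
    Summable fun l : Fin w.length → ℕ => actTerm (ξ ^ p ^ α) (locDual ξ (p ^ α) g)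
      (fun v => ((m : ℕ) : K) ^ (W - v.weight) * f m v) k' (decorate (w, k') l) k B L out := by
  have := charZero_of_padic p (K := K)
  have := isUltrametricDist_of_padic p (K := K)
  have hη : (ξ ^ p ^ α) ^ N = 1 := by rw [← pow_mul, mul_comm, pow_mul, hξ, one_pow]
  have hm0 : ((m : ℕ) : K) ≠ 0 := by exact_mod_cast m.ne_zero
  obtain ⟨C₁, ρ, hC₁, hρ0, hρ1, hloc⟩ := exists_norm_locDual_le p hpN hξ hα hg d c
  -- The midpoint of `1` and `1 / ρ`: large enough to dominate polynomial growth, small enough that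
  -- `ρ s < 1`.
  set s : ℝ := (1 + ρ⁻¹) / 2 with hs
  have hρi : 1 < ρ⁻¹ := (one_lt_inv₀ hρ0).2 hρ1
  have hs1 : 1 < s := by rw [hs]; linarith
  have hs0 : 0 < s := one_pos.trans hs1
  have hτ : ρ * s < 1 := by
    rw [hs, mul_div_assoc', mul_add, mul_inv_cancel₀ hρ0.ne']
    linarith
  choose A e hA using fun i => hf m i c
  choose D hD0 hD using fun i => exists_pow_le_const_mul_pow (e i) hs1
  set M : ℝ := ‖((m : ℕ) : K)‖ ^ W with hM
  have hM0 : 0 ≤ M := by positivity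
  -- Temperedness gives one constant per depth; their sum serves all depths up to `d`.
  set C₂ : ℝ := ∑ i ∈ Finset.range (d + 1), M * (|A i| * D i) with hC₂
  have hF : ∀ out : List (ℤ × ZMod N), out.length ≤ d → (∀ a ∈ out, a.1 ≤ c) →
      ‖((m : ℕ) : K) ^ (W - LocWord.weight (out, k')) * f m (out, k')‖ ≤
        C₂ * s ^ LocWord.absWeight (out, k') := by
    intro out ho hoc
    have hn0 : ‖((m : ℕ) : K)‖ ≠ 0 := norm_ne_zero_iff.2 hm0
    have h1 := hA out.length (out, k') rfl hoc
    have h2 : M * (|A out.length| * D out.length) ≤ C₂ :=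
      Finset.single_le_sum (f := fun i => M * (|A i| * D i))
        (fun i _ => mul_nonneg hM0 (mul_nonneg (abs_nonneg _) (hD0 i)))
        (Finset.mem_range.2 (by omega))
    rw [norm_mul, norm_zpow, zpow_sub₀ hn0]
    set V := LocWord.weight (out, k')
    set a := LocWord.absWeight (out, k')
    have hV : 0 < ‖((m : ℕ) : K)‖ ^ V := zpow_pos (norm_pos_iff.2 hm0) _
    calc _ ≤ M / ‖((m : ℕ) : K)‖ ^ V * (|A out.length| * (D out.length * s ^ a) *
          ‖((m : ℕ) : K)‖ ^ V) := by
          refine mul_le_mul_of_nonneg_left (h1.trans ?_) (by positivity)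
          refine mul_le_mul_of_nonneg_right ?_ hV.le
          exact mul_le_mul (le_abs_self _) (hD _ a) (by positivity) (abs_nonneg _)
      _ = M * (|A out.length| * D out.length) * s ^ a := by
          field_simp
      _ ≤ _ := by gcongr
  set C := max 1 (max C₁ C₂) with hC
  have hC1 : 1 ≤ C := le_max_left _ _
  have hgf : ∀ (B : List (ℤ × ZMod N)) (k : ZMod N), B.length ≤ d → (∀ a ∈ B, -(c : ℤ) ≤ a.1) →
      ‖groupFactor (ξ ^ p ^ α) (locDual ξ (p ^ α) g) B k‖ ≤ C * ρ ^ LocWord.weight (B, k) := by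
    intro B k hB hBc
    rw [groupFactor]
    split_ifs with h
    · subst h
      simpa [LocWord.weight] using hC1
    · rw [norm_mul, norm_rootPow hη, one_mul]
      refine (hloc (B, k) hB hBc).trans ?_
      gcongr
      exact (le_max_left _ _).trans (le_max_right _ _)
  refine Summable.of_norm_bounded ((summable_pow_sum (by positivity) hτ w.length).mul_left
    (C ^ 2 * (3 * C * (s / ρ) ^ c) ^ w.length * ρ ^ LocWord.weight (B, k) *
      s ^ (LocWord.absWeight (out, k') + L))) fun l => ?_
  have hdec : ∀ a ∈ decorate (w, k') l, a.1.natAbs ≤ c := fun a ha =>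
    hw _ (mem_of_mem_decorate ha)
  have hlen : (decorate (w, k') l).length = w.length := by simp [decorate]
  have h := norm_actTerm_le (η := ξ ^ p ^ α) (g := locDual ξ (p ^ α) g)
    (F := fun v => ((m : ℕ) : K) ^ (W - v.weight) * f m v) (k' := k') (d := d) (c := c)
    hC1 hρ0 hρ1 hs1.le hgf (fun out ho hoc => (hF out ho hoc).trans (by
      gcongr
      exact (le_max_right _ _).trans (le_max_right _ _))) (decorate (w, k') l) hdec k B L out
    (by omega) hBc (by omega) hoc
  rwa [sum_map_decorate, hlen] at h

theorem summable_actionTerm (p : ℕ) [Fact p.Prime] [NeZero N] [NormedAlgebra ℚ_[p] K]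
    [CompleteSpace K] (hpN : p.Coprime N) {ξ : K} (hξ : ξ ^ N = 1) {α : ℕ} (hα : 0 < α)
    {g : HarWord N → K} {f : ℕ+ → LocWord N → K} (hg : IsSummableSeq g) (hf : IsTempered f)
    (m : ℕ+) (w : LocWord N) : Summable (actionTerm p α ξ g f m w) :=
  summable_actTerm p hpN hξ hα hg hf m w.weight w.2 w.1.length w.absWeight w.1
    (fun _ ha => List.single_le_sum (by simp) _ (List.mem_map.2 ⟨_, ha, rfl⟩))
    w.2 [] 0 [] (by simp) (by simp) (by simp) (by simp)

end ActTerm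

/-! ### Iterated sums with a prescribed innermost function -/

section NestSum

variable {N : ℕ} {K : Type*} [Field K]

/-- The iterated sum of a function of the last index and of the smallest variable. -/
def nestSum (ξ : K) : List (ℤ × ZMod N) → ZMod N → (ZMod N → ℕ → K) → ℕ → K
  | [], k, h, x => h k x
  | (n, j) :: w, k, h, x =>
      ∑ y ∈ Finset.Ico 1 x, (rootPow ξ k / rootPow ξ j) ^ y / (y : K) ^ n * nestSum ξ w j h y

theorem nestSum_append (ξ : K) (u v : List (ℤ × ZMod N)) (k : ZMod N) (h : ZMod N → ℕ → K)
    (x : ℕ) : nestSum ξ (u ++ v) k h x = nestSum ξ u k (fun j y => nestSum ξ v j h y) x := by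
  induction u generalizing k x with
  | nil => rfl
  | cons a u ih => simp only [List.cons_append, nestSum, ih]

theorem nestSum_one (ξ : K) (w : List (ℤ × ZMod N)) (k : ZMod N) (x : ℕ) :
    nestSum ξ w k (fun _ _ => 1) x = iterSum ξ w k x := by
  induction w generalizing k x with
  | nil => rfl
  | cons a w ih => simp only [nestSum, iterSum, ih]

theorem nestSum_congr (ξ : K) (w : List (ℤ × ZMod N)) (k : ZMod N) {h h' : ZMod N → ℕ → K}
    {x : ℕ} (hx : 0 < x) (hh : ∀ j y, 0 < y → y ≤ x → h j y = h' j y) :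
    nestSum ξ w k h x = nestSum ξ w k h' x := by
  induction w generalizing k x with
  | nil => exact hh k x hx le_rfl
  | cons a w ih =>
    refine Finset.sum_congr rfl fun y hy => ?_
    obtain ⟨hy1, hy2⟩ := Finset.mem_Ico.1 hy
    rw [ih _ hy1 fun j z hz hzy => hh j z hz (hzy.trans hy2.le)]

theorem nestSum_add (ξ : K) (w : List (ℤ × ZMod N)) (k : ZMod N) (h h' : ZMod N → ℕ → K) (x : ℕ) :
    nestSum ξ w k (fun j y => h j y + h' j y) x = nestSum ξ w k h x + nestSum ξ w k h' x := by
  induction w generalizing k x with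
  | nil => rfl
  | cons a w ih => simp only [nestSum, ih, mul_add, Finset.sum_add_distrib]

theorem nestSum_mul_left (ξ : K) (w : List (ℤ × ZMod N)) (k : ZMod N) (c : K)
    (h : ZMod N → ℕ → K) (x : ℕ) :
    nestSum ξ w k (fun j y => c * h j y) x = c * nestSum ξ w k h x := by
  induction w generalizing k x with
  | nil => rfl
  | cons a w ih => simp only [nestSum, ih, Finset.mul_sum, mul_left_comm]

theorem nestSum_const (ξ : K) (w : List (ℤ × ZMod N)) (k : ZMod N) (c : K) (x : ℕ) :
    nestSum ξ w k (fun _ _ => c) x = c * iterSum ξ w k x := by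
  rw [← nestSum_one, ← nestSum_mul_left]
  simp only [mul_one]

theorem hasSum_nestSum {K : Type*} [NormedField K] (ξ : K) (w : List (ℤ × ZMod N)) (k : ZMod N)
    {ι : Type*} {h : ι → ZMod N → ℕ → K} {h' : ZMod N → ℕ → K} {x : ℕ} (hx : 0 < x)
    (hh : ∀ j y, 0 < y → y ≤ x → HasSum (fun i => h i j y) (h' j y)) :
    HasSum (fun i => nestSum ξ w k (h i) x) (nestSum ξ w k h' x) := by
  induction w generalizing k x with
  | nil => exact hh k x hx le_rfl
  | cons a w ih =>
    refine hasSum_sum fun y hy => ?_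
    obtain ⟨hy1, hy2⟩ := Finset.mem_Ico.1 hy
    exact (ih _ hy1 fun j z hz hzy => hh j z hz (hzy.trans hy2.le)).mul_left _

/-- The last letter determines the index passed to the innermost function, which may therefore be
frozen at `j`. -/
theorem nestSum_append_singleton (ξ : K) (w : List (ℤ × ZMod N)) (t : ℤ) (j k : ZMod N)
    (h : ZMod N → ℕ → K) (x : ℕ) : nestSum ξ (w ++ [(t, j)]) k h x =
      nestSum ξ (w ++ [(t, j)]) k (fun _ y => h j y) x := by
  rw [nestSum_append, nestSum_append]
  rfl

/-- The iterated sum, with value `0` at `0`. -/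
def iterSumZero (ξ : K) (w : List (ℤ × ZMod N)) (k : ZMod N) (x : ℕ) : K :=
  if x = 0 then 0 else iterSum ξ w k x

theorem iterSumZero_zero (ξ : K) (w : List (ℤ × ZMod N)) (k : ZMod N) :
    iterSumZero ξ w k 0 = 0 := if_pos rfl

theorem iterSumZero_of_pos (ξ : K) (w : List (ℤ × ZMod N)) (k : ZMod N) {x : ℕ} (hx : 0 < x) :
    iterSumZero ξ w k x = iterSum ξ w k x := if_neg hx.ne'

/-- The value `0` at `0` kills the term `t = 0`, whatever its power means there, so the sums can
start at `0` and be cut at multiples of `q`. -/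
theorem iterSumZero_cons (ξ : K) (n : ℤ) (j : ZMod N) (w : List (ℤ × ZMod N)) (k : ZMod N)
    (x : ℕ) : iterSumZero ξ ((n, j) :: w) k x = ∑ t ∈ Finset.range x,
      (rootPow ξ k / rootPow ξ j) ^ t / (t : K) ^ n * iterSumZero ξ w j t := by
  rcases Nat.eq_zero_or_pos x with rfl | hx
  · simp [iterSumZero]
  · rw [iterSumZero_of_pos _ _ _ hx, iterSum, Finset.range_eq_Ico,
      Finset.sum_eq_sum_Ico_succ_bot hx, iterSumZero_zero, mul_zero, zero_add]
    refine Finset.sum_congr rfl fun t ht => ?_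
    rw [iterSumZero_of_pos _ _ _ (Finset.mem_Ico.1 ht).1]

theorem iterSumZero_cons_sub (ξ : K) (n : ℤ) (j : ZMod N) (w : List (ℤ × ZMod N)) (k : ZMod N)
    (x r : ℕ) : iterSumZero ξ ((n, j) :: w) k (x + r) - iterSumZero ξ ((n, j) :: w) k x =
      ∑ t ∈ Finset.range r, (rootPow ξ k / rootPow ξ j) ^ (x + t) / ((x + t : ℕ) : K) ^ n *
        iterSumZero ξ w j (x + t) := by
  rw [iterSumZero_cons, iterSumZero_cons, Finset.sum_range_add, add_sub_cancel_left]

end NestSum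

/-! ### Sums over quotients and residues -/

section Quotients

variable {N : ℕ} {K : Type*} [Field K]

/-- The sum over the quotients and residues modulo `q` that is expanded by `actTerm`: the
quotient `u < y` is the current one, `B` consists of the larger residues of this quotient, and
the largest variable of `w` is `q u + t`, with `t` less than the smallest of these residues. -/
noncomputable def blockSum (ξ : K) (q : ℕ) (w : List (ℤ × ZMod N)) (k : ZMod N)
    (B : List (ℤ × ZMod N)) (L y : ℕ) : K :=
  ∑ u ∈ Finset.range y, rootPow (ξ ^ q) k ^ u * (u : K) ^ L * (q : K) ^ LocWord.weight (B, k) *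
    nestSum ξ B k (fun j r => (rootPow (ξ ^ q) j ^ u)⁻¹ * ((q : K) ^ LocWord.weight (w, j) *
      (iterSumZero ξ w j (q * u + r) - iterSumZero ξ w j (q * u)))) q

variable [NeZero N] {ξ : K}

/-- With no pending residue, the sum over `u` telescopes. -/
theorem blockSum_nil_zero (hξ : ξ ^ N = 1) (q : ℕ) (w : List (ℤ × ZMod N)) (k : ZMod N) (y : ℕ) :
    blockSum ξ q w k [] 0 y = (q : K) ^ LocWord.weight (w, k) * iterSumZero ξ w k (q * y) := by
  have hη : (ξ ^ q) ^ N = 1 := by rw [← pow_mul, mul_comm, pow_mul, hξ, one_pow]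
  have h : ∀ u : ℕ, rootPow (ξ ^ q) k ^ u ≠ 0 := fun u => pow_ne_zero _ (rootPow_ne_zero hη k)
  have hw : LocWord.weight (([] : List (ℤ × ZMod N)), k) = 0 := by simp [LocWord.weight]
  have hs := Finset.sum_range_sub (fun u => iterSumZero ξ w k (q * u)) y
  rw [mul_zero, iterSumZero_zero, sub_zero] at hs
  rw [← hs, blockSum, Finset.mul_sum]
  refine Finset.sum_congr rfl fun u _ => ?_
  rw [nestSum, hw, zpow_zero, pow_zero, mul_one, mul_one, mul_inv_cancel_left₀ (h u), mul_add_one]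

omit [NeZero N] in
-- On the empty word `iterSumZero` is the indicator of the positive integers, so its increment is
-- nonzero only for `u = 0`. The empty word thus behaves like a variable `m_0 = 0`, and `0 ^ L` is
-- the value of `u ^ L`.
theorem blockSum_nil (q : ℕ) (hq : 0 < q) (k : ZMod N) (B : List (ℤ × ZMod N)) (L : ℕ) {y : ℕ}
    (hy : 0 < y) : blockSum ξ q [] k B L y =
      0 ^ L * ((q : K) ^ LocWord.weight (B, k) * iterSum ξ B k q) := by
  have hw : ∀ k, LocWord.weight (([] : List (ℤ × ZMod N)), k) = 0 := by simp [LocWord.weight]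
  rw [blockSum, Finset.sum_eq_single_of_mem 0 (Finset.mem_range.2 hy)]
  · rw [nestSum_congr ξ B k (h' := fun _ _ => 1) hq, nestSum_one]
    · simp [mul_assoc]
    · intro j r hr _
      simp [hw, iterSumZero, iterSum, hr.ne']
  · intro u _ hu
    rw [nestSum_congr ξ B k (h' := fun _ _ => 0) hq, nestSum_const]
    · simp
    · intro j r hr _
      simp [iterSumZero, iterSum, hr.ne', hu, hq.ne']

end Quotients

/-! ### Binomial expansion of one variable -/

section Expansion

theorem HasSum.of_eq {ι M : Type*} [AddCommMonoid M] [TopologicalSpace M] {f g : ι → M} {a b : M}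
    (h : HasSum f a) (hf : ∀ i, g i = f i) (ha : b = a) : HasSum g b := by
  rw [funext hf, ha]
  exact h

variable {N : ℕ} [NeZero N] {K : Type*} [NormedField K] [CharZero K] {ξ : K} {q : ℕ}

/-- The largest variable is `q u + t` with `0 ≤ t < r`. The term `t = 0` is exact and is placed at
`l = 0` by `0 ^ l`; the terms `t > 0` are expanded, `‖q / t * u‖ < 1` ensuring convergence. -/
theorem hasSum_residue (hξ : ξ ^ N = 1) (hq : 0 < q)
    (hqr : ∀ r : ℕ, 0 < r → r < q → ‖(q : K) / r‖ < 1) (hnat : ∀ u : ℕ, ‖(u : K)‖ ≤ 1)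
    (n : ℤ) (j : ZMod N) (w : List (ℤ × ZMod N)) (u : ℕ) (k : ZMod N) {r : ℕ} (hr : 0 < r)
    (hrq : r ≤ q) :
    HasSum (fun l : ℕ => 0 ^ l * ((rootPow (ξ ^ q) j ^ u)⁻¹ * ((u : K) ^ n)⁻¹ *
        ((q : K) ^ LocWord.weight (w, j) * iterSumZero ξ w j (q * u))) +
      ((Ring.choose (-n) l : ℤ) : K) * (u : K) ^ l * (q : K) ^ (n + (l : ℤ)) *
        nestSum ξ [(n + (l : ℤ), j)] k (fun j t => (rootPow (ξ ^ q) j ^ u)⁻¹ *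
          ((q : K) ^ LocWord.weight (w, j) * iterSumZero ξ w j (q * u + t))) r)
      ((rootPow (ξ ^ q) k ^ u)⁻¹ * ((q : K) ^ LocWord.weight ((n, j) :: w, k) *
        (iterSumZero ξ ((n, j) :: w) k (q * u + r) - iterSumZero ξ ((n, j) :: w) k (q * u)))) := by
  have hq0 : (q : K) ≠ 0 := by exact_mod_cast hq.ne'
  have hk0 := rootPow_ne_zero hξ k
  have hj0 := rootPow_ne_zero hξ j
  have hwt : LocWord.weight ((n, j) :: w, k) = n + LocWord.weight (w, j) := by
    simp [LocWord.weight]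
  rw [iterSumZero_cons_sub, Finset.range_eq_Ico, Finset.sum_eq_sum_Ico_succ_bot hr, hwt,
    zpow_add₀ hq0, mul_add, mul_add, rootPow_pow, rootPow_pow]
  set W := (q : K) ^ LocWord.weight (w, j) with hW
  refine HasSum.add ?_ ?_
  · have h1 : HasSum (fun l : ℕ => (0 : K) ^ l) 1 := by
      exact HasSum.of_eq (hasSum_ite_eq 0 (1 : K)) (fun l => zero_pow_eq l) rfl
    refine HasSum.of_eq (h1.mul_right _) (fun _ => rfl) ?_
    rw [one_mul, add_zero, ← pow_mul, ← pow_mul, div_pow]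
    -- For `u = t = 0` the variable would be `0`; both sides vanish because `iterSumZero` does.
    rcases Nat.eq_zero_or_pos u with rfl | hu
    · simp [iterSumZero_zero]
    · have hu0 : (u : K) ≠ 0 := by exact_mod_cast hu.ne'
      push_cast
      rw [mul_zpow]
      field_simp
  · have key : ∀ t ∈ Finset.Ico 1 r, HasSum (fun l : ℕ => ((Ring.choose (-n) l : ℤ) : K) *
        (u : K) ^ l * (q : K) ^ (n + (l : ℤ)) * ((rootPow ξ k / rootPow ξ j) ^ t /
          (t : K) ^ (n + (l : ℤ)) * (((rootPow ξ j ^ q) ^ u)⁻¹ * (W * iterSumZero ξ w j (q * u + t)))))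
        (((rootPow ξ k ^ q) ^ u)⁻¹ * ((q : K) ^ n * W * ((rootPow ξ k / rootPow ξ j) ^ (q * u + t) /
          ((q * u + t : ℕ) : K) ^ n * iterSumZero ξ w j (q * u + t)))) := by
      intro t ht
      obtain ⟨ht1, ht2⟩ := Finset.mem_Ico.1 ht
      have ht0 : (t : K) ≠ 0 := by exact_mod_cast (by omega : t ≠ 0)
      have hqt0 : ((q * u + t : ℕ) : K) ≠ 0 := by exact_mod_cast (by omega : q * u + t ≠ 0)
      have hx : ‖(q : K) / t * u‖ < 1 := by
        rw [norm_mul]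
        exact (mul_le_of_le_one_right (norm_nonneg _) (hnat u)).trans_lt (hqr t ht1 (by omega))
      have h := (hasSum_choose_zpow (-n) hx).mul_right (((q : K) / t) ^ n *
        ((rootPow ξ k / rootPow ξ j) ^ t * (((rootPow ξ j ^ q) ^ u)⁻¹ *
          (W * iterSumZero ξ w j (q * u + t)))))
      refine HasSum.of_eq h (fun l => ?_) ?_
      · rw [zpow_add₀ hq0, zpow_add₀ ht0, zpow_natCast, zpow_natCast, mul_pow, div_pow (q : K),
          div_zpow]
        field_simp
      · have e1 : (1 + (q : K) / t * u) = ((q * u + t : ℕ) : K) / t := by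
          push_cast
          field_simp
          ring
        rw [e1, zpow_neg, div_zpow, div_zpow, pow_add, ← pow_mul, ← pow_mul, div_pow, div_pow]
        have := zpow_ne_zero n hqt0
        field_simp
    have h := hasSum_sum key
    refine HasSum.of_eq h (fun l => ?_) ?_
    · simp only [nestSum, Finset.mul_sum, hW]
      refine Finset.sum_congr rfl fun t _ => ?_
      rw [rootPow_pow]
    · simp only [Finset.mul_sum]

/-- The analytic counterpart of the recursion of `actTerm`. Its first summand is the zero residue;
the other two separate a next variable with smaller quotient from one with the same quotient. -/
theorem hasSum_blockSum (hξ : ξ ^ N = 1) (hq : 0 < q)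
    (hqr : ∀ r : ℕ, 0 < r → r < q → ‖(q : K) / r‖ < 1) (hnat : ∀ u : ℕ, ‖(u : K)‖ ≤ 1)
    (n : ℤ) (j : ZMod N) (w : List (ℤ × ZMod N)) (k : ZMod N) (B : List (ℤ × ZMod N)) (L y : ℕ) :
    HasSum (fun l : ℕ =>
      0 ^ l * ((q : K) ^ LocWord.weight (B, k) * iterSum ξ B k q) *
        nestSum (ξ ^ q) [(n - (L : ℤ), j)] k (fun i x => blockSum ξ q w i [] 0 x) y +
      ((Ring.choose (-n) l : ℤ) : K) *
        ((q : K) ^ LocWord.weight (B ++ [(n + (l : ℤ), j)], k) *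
          iterSum ξ (B ++ [(n + (l : ℤ), j)]) k q) *
        nestSum (ξ ^ q) [(-((L : ℤ) + (l : ℤ)), j)] k (fun i x => blockSum ξ q w i [] 0 x) y +
      ((Ring.choose (-n) l : ℤ) : K) * blockSum ξ q w k (B ++ [(n + (l : ℤ), j)]) (L + l) y)
      (blockSum ξ q ((n, j) :: w) k B L y) := by
  have hq0 : (q : K) ≠ 0 := by exact_mod_cast hq.ne'
  have hη : (ξ ^ q) ^ N = 1 := by rw [← pow_mul, mul_comm, pow_mul, hξ, one_pow]
  have hs := hasSum_sum (s := Finset.range y) fun u _ => (hasSum_nestSum ξ B k hq fun k₀ r hr hrq =>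
    hasSum_residue hξ hq hqr hnat n j w u k₀ hr hrq).mul_left
      (rootPow (ξ ^ q) k ^ u * (u : K) ^ L * (q : K) ^ LocWord.weight (B, k))
  refine HasSum.of_eq hs (fun l => ?_) rfl
  have hlast : ∀ t : ℤ, nestSum (ξ ^ q) [(t, j)] k (fun i x => blockSum ξ q w i [] 0 x) y =
      ∑ u ∈ Finset.range y, (rootPow (ξ ^ q) k / rootPow (ξ ^ q) j) ^ u / (u : K) ^ t *
        ((q : K) ^ LocWord.weight (w, j) * iterSumZero ξ w j (q * u)) := by
    intro t
    simp only [nestSum, blockSum_nil_zero hξ]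
    rcases Nat.eq_zero_or_pos y with rfl | hy
    · simp
    · rw [Finset.range_eq_Ico, Finset.sum_eq_sum_Ico_succ_bot hy]
      simp [iterSumZero_zero]
  have hwB : LocWord.weight (B ++ [(n + (l : ℤ), j)], k) =
      LocWord.weight (B, k) + (n + (l : ℤ)) := by
    rw [LocWord.weight_append]
    simp [LocWord.weight]
  rw [hlast, hlast, blockSum, Finset.mul_sum, Finset.mul_sum, Finset.mul_sum,
    ← Finset.sum_add_distrib, ← Finset.sum_add_distrib]
  refine Finset.sum_congr rfl fun u _ => ?_
  rw [nestSum_add, nestSum_const, nestSum_mul_left, ← nestSum_append, hwB, zpow_add₀ hq0]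
  -- Below `q u + t`, the next variable lies either below `q u` (smaller quotient) or in the
  -- interval from `q u` to `q u + t` (same quotient).
  have hsplit : nestSum ξ (B ++ [(n + (l : ℤ), j)]) k (fun i t => (rootPow (ξ ^ q) i ^ u)⁻¹ *
      ((q : K) ^ LocWord.weight (w, j) * iterSumZero ξ w i (q * u + t))) q =
      nestSum ξ (B ++ [(n + (l : ℤ), j)]) k (fun i t => (rootPow (ξ ^ q) i ^ u)⁻¹ *
        ((q : K) ^ LocWord.weight (w, i) *
          (iterSumZero ξ w i (q * u + t) - iterSumZero ξ w i (q * u)))) q +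
      (rootPow (ξ ^ q) j ^ u)⁻¹ * ((q : K) ^ LocWord.weight (w, j) * iterSumZero ξ w j (q * u)) *
        iterSum ξ (B ++ [(n + (l : ℤ), j)]) k q := by
    rw [nestSum_append_singleton, nestSum_append_singleton ξ B _ _ _ (fun i t =>
      (rootPow (ξ ^ q) i ^ u)⁻¹ * ((q : K) ^ LocWord.weight (w, i) *
          (iterSumZero ξ w i (q * u + t) - iterSumZero ξ w i (q * u)))), ← nestSum_const,
      ← nestSum_add]
    congr 1
    funext _ t
    ring
  have hsplit' := hsplit
  simp only [LocWord.weight] at hsplit' ⊢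
  rw [hsplit']
  have hj0 := rootPow_ne_zero hη j
  -- At `u = 0` the possibly meaningless powers of `0` are multiplied by `iterSumZero ... 0 = 0`.
  rcases Nat.eq_zero_or_pos u with rfl | hu
  · rw [mul_zero, iterSumZero_zero]
    simp only [pow_zero, mul_zero, zero_mul, add_zero, zero_add, pow_add]
    ring
  · have hu0 : (u : K) ≠ 0 := by exact_mod_cast hu.ne'
    rw [zpow_sub₀ hu0, zpow_neg, zpow_add₀ hu0, zpow_natCast, zpow_natCast, div_pow, pow_add]
    field_simp
    ring

end Expansion

/-! ### Resummation and the identity for multiple harmonic sums -/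

section Identity

variable {N : ℕ} [NeZero N] {K : Type*} [NormedField K]

omit [NeZero N] in
theorem decorate_cons (n : ℤ) (j k : ZMod N) (w : List (ℤ × ZMod N)) (l : ℕ)
    (ls : Fin w.length → ℕ) :
    decorate (((n, j) :: w, k) : LocWord N) (Fin.cons l ls) = (n, j, l) :: decorate (w, k) ls := by
  simp [decorate, List.ofFn_succ]

/-- Split off the index of the largest untreated variable, apply the induction hypothesis to each of
the three branches, then resum that index by `hasSum_blockSum` inside the outer sum. The hypothesis
`hk` records that `k` is the index following `out`, and `κ` collects the factors independent of
`out`. -/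
theorem tsum_actTerm [CharZero K] [CompleteSpace K] {ξ : K} (hξ : ξ ^ N = 1) {q : ℕ} (hq : 0 < q)
    (hqr : ∀ r : ℕ, 0 < r → r < q → ‖(q : K) / r‖ < 1) (hnat : ∀ u : ℕ, ‖(u : K)‖ ≤ 1)
    {g F : LocWord N → K} {k' : ZMod N} {m : ℕ} (hm : 0 < m) {κ : K}
    (hg : ∀ (B : List (ℤ × ZMod N)) (k : ZMod N), groupFactor (ξ ^ q) g B k =
      (q : K) ^ LocWord.weight (B, k) * iterSum ξ B k q)
    (hF : ∀ out : List (ℤ × ZMod N), F (out, k') = κ * iterSum (ξ ^ q) out k' m) {d c : ℕ}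
    (hsum : ∀ w : List (ℤ × ZMod N), (∀ a ∈ w, a.1.natAbs ≤ c) →
      ∀ (k : ZMod N) (B : List (ℤ × ZMod N)) (L : ℕ) (out : List (ℤ × ZMod N)),
        B.length + w.length ≤ d → (∀ a ∈ B, -(c : ℤ) ≤ a.1) →
        out.length + w.length ≤ d → (∀ a ∈ out, a.1 ≤ c) →
        Summable fun l : Fin w.length → ℕ =>
          actTerm (ξ ^ q) g F k' (decorate (w, k') l) k B L out)
    (w : List (ℤ × ZMod N)) (hw : ∀ a ∈ w, a.1.natAbs ≤ c) (k : ZMod N)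
    (B : List (ℤ × ZMod N)) (L : ℕ) (out : List (ℤ × ZMod N))
    (hBd : B.length + w.length ≤ d) (hBc : ∀ a ∈ B, -(c : ℤ) ≤ a.1)
    (hod : out.length + w.length ≤ d) (hoc : ∀ a ∈ out, a.1 ≤ c)
    (hk : ∀ (h : ZMod N → ℕ → K) (x : ℕ),
      nestSum (ξ ^ q) out k' h x = nestSum (ξ ^ q) out k' (fun _ y => h k y) x) :
    ∑' l : Fin w.length → ℕ, actTerm (ξ ^ q) g F k' (decorate (w, k') l) k B L out =
      κ * nestSum (ξ ^ q) out k' (fun _ y => blockSum ξ q w k B L y) m := by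
  induction w generalizing k B L out with
  | nil =>
    rw [nestSum_congr (ξ ^ q) out k' hm fun _ y hy _ => blockSum_nil q hq k B L hy, nestSum_const]
    have h1 : ∀ l : Fin ([] : List (ℤ × ZMod N)).length → ℕ,
        actTerm (ξ ^ q) g F k' (decorate (([] : List (ℤ × ZMod N)), k') l) k B L out =
          κ * (0 ^ L * ((q : K) ^ LocWord.weight (B, k) * iterSum ξ B k q) *
            iterSum (ξ ^ q) out k' m) := by
      intro l
      have : decorate (([] : List (ℤ × ZMod N)), k') l = [] := by simp [decorate]
      rw [this, actTerm, hg, hF]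
      ring
    simp only [h1]
    exact tsum_eq_single (β := Fin 0 → ℕ) default fun b hb => absurd (Subsingleton.elim b _) hb
  | cons a w ih =>
    obtain ⟨n, j⟩ := a
    have hn : n.natAbs ≤ c := hw (n, j) List.mem_cons_self
    have hw' : ∀ a ∈ w, a.1.natAbs ≤ c := fun a ha => hw a (List.mem_cons_of_mem _ ha)
    have hS := hsum ((n, j) :: w) hw k B L out hBd hBc hod hoc
    have hlen : ((n, j) :: w).length = w.length + 1 := rfl
    rw [hlen] at hBd hod
    have hBc' : ∀ l : ℕ, ∀ a ∈ B ++ [(n + (l : ℤ), j)], -(c : ℤ) ≤ a.1 := by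
      intro l a ha
      rcases List.mem_append.1 ha with ha | ha
      · exact hBc a ha
      · rw [List.mem_singleton.1 ha]
        simp only
        omega
    have hout : ∀ t : ℤ, t ≤ c → ∀ a ∈ out ++ [(t, j)], a.1 ≤ c := by
      intro t ht a ha
      rcases List.mem_append.1 ha with ha | ha
      · exact hoc a ha
      · rw [List.mem_singleton.1 ha]
        exact ht
    set e : ℕ × (Fin w.length → ℕ) ≃ (Fin ((n, j) :: w).length → ℕ) :=
      Fin.consEquiv fun _ : Fin (w.length + 1) => ℕ with he
    have hterm : ∀ (l : ℕ) (ls : Fin w.length → ℕ),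
        actTerm (ξ ^ q) g F k' (decorate ((n, j) :: w, k') (e (l, ls))) k B L out =
        0 ^ l * groupFactor (ξ ^ q) g B k * actTerm (ξ ^ q) g F k' (decorate (w, k') ls) j [] 0
            (out ++ [(n - (L : ℤ), j)])
        + ((Ring.choose (-n) l : ℤ) : K) *
            groupFactor (ξ ^ q) g (B ++ [(n + (l : ℤ), j)]) k *
            actTerm (ξ ^ q) g F k' (decorate (w, k') ls) j [] 0
              (out ++ [(-((L : ℤ) + (l : ℤ)), j)])
        + ((Ring.choose (-n) l : ℤ) : K) *
            actTerm (ξ ^ q) g F k' (decorate (w, k') ls) k (B ++ [(n + (l : ℤ), j)]) (L + l) out := by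
      intro l ls
      have h1 : e (l, ls) = (Fin.cons l ls : Fin (w.length + 1) → ℕ) := rfl
      rw [h1, decorate_cons, actTerm]
    rw [← e.tsum_eq]
    rw [← e.summable_iff] at hS
    refine hS.tsum_prod.trans ?_
    have hlast : ∀ t : ℤ, nestSum (ξ ^ q) (out ++ [(t, j)]) k'
        (fun _ y => blockSum ξ q w j [] 0 y) m = nestSum (ξ ^ q) out k' (fun _ y =>
          nestSum (ξ ^ q) [(t, j)] k (fun i x => blockSum ξ q w i [] 0 x) y) m := by
      intro t
      rw [nestSum_append, hk]
      rfl
    have hk' : ∀ (t : ℤ) (h : ZMod N → ℕ → K) (x : ℕ), nestSum (ξ ^ q) (out ++ [(t, j)]) k' h x =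
        nestSum (ξ ^ q) (out ++ [(t, j)]) k' (fun _ y => h j y) x := fun t h x =>
      nestSum_append_singleton _ _ _ _ _ _ _
    have hinner : ∀ l : ℕ, ∑' ls : Fin w.length → ℕ,
        actTerm (ξ ^ q) g F k' (decorate ((n, j) :: w, k') (e (l, ls))) k B L out =
        κ * nestSum (ξ ^ q) out k' (fun _ y =>
          0 ^ l * ((q : K) ^ LocWord.weight (B, k) * iterSum ξ B k q) *
            nestSum (ξ ^ q) [(n - (L : ℤ), j)] k (fun i x => blockSum ξ q w i [] 0 x) y +
          ((Ring.choose (-n) l : ℤ) : K) *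
            ((q : K) ^ LocWord.weight (B ++ [(n + (l : ℤ), j)], k) *
              iterSum ξ (B ++ [(n + (l : ℤ), j)]) k q) *
            nestSum (ξ ^ q) [(-((L : ℤ) + (l : ℤ)), j)] k
              (fun i x => blockSum ξ q w i [] 0 x) y +
          ((Ring.choose (-n) l : ℤ) : K) *
            blockSum ξ q w k (B ++ [(n + (l : ℤ), j)]) (L + l) y) m := by
      intro l
      simp only [hterm]
      have s1 := hsum w hw' j [] 0 (out ++ [(n - (L : ℤ), j)]) (by simp; omega) (by simp)
        (by simp; omega) (hout _ (by omega))
      have s2 := hsum w hw' j [] 0 (out ++ [(-((L : ℤ) + (l : ℤ)), j)]) (by simp; omega) (by simp)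
        (by simp; omega) (hout _ (by omega))
      have s3 := hsum w hw' k (B ++ [(n + (l : ℤ), j)]) (L + l) out (by simp; omega) (hBc' l)
        (by omega) hoc
      rw [((s1.mul_left _).add (s2.mul_left _)).tsum_add (s3.mul_left _),
        (s1.mul_left _).tsum_add (s2.mul_left _), tsum_mul_left, tsum_mul_left, tsum_mul_left,
        ih hw' j [] 0 _ (by simp; omega) (by simp) (by simp; omega) (hout _ (by omega)) (hk' _),
        ih hw' j [] 0 _ (by simp; omega) (by simp) (by simp; omega) (hout _ (by omega)) (hk' _),
        ih hw' k _ _ _ (by simp; omega) (hBc' l) (by omega) hoc hk, hlast, hlast, hg, hg,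
        nestSum_add, nestSum_add, nestSum_mul_left, nestSum_mul_left, nestSum_mul_left]
      ring
    -- The outer sum over quotients is finite, so the one-variable expansion passes through it.
    have hfin := (hasSum_nestSum (ξ ^ q) out k' hm fun _ y _ _ =>
      hasSum_blockSum hξ hq hqr hnat n j w k B L y).mul_left κ
    rw [← hfin.tsum_eq]
    exact tsum_congr hinner

/-- The recursion starts with no pending residue and an empty outer word, so its total telescopes to
the full sum below `p ^ α * m`. The factor `η ^ k` in `groupFactor` cancels the last root of unity
in `har` at `p ^ α`. -/
theorem harLoc_mul_eq_actionLocLoc (p : ℕ) [Fact p.Prime] [NormedAlgebra ℚ_[p] K]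
    [CompleteSpace K] (hpN : p.Coprime N) {ξ : K} (hξ : ξ ^ N = 1) {α : ℕ} (hα : 0 < α) :
    (fun m : ℕ+ => harLoc (N := N) ξ (p ^ α * m)) =
      actionLocLoc p α ξ (har ξ (p ^ α)) (fun m : ℕ+ => harLoc (ξ ^ p ^ α) m) := by
  have := charZero_of_padic p (K := K)
  have := isUltrametricDist_of_padic p (K := K)
  have hη : (ξ ^ p ^ α) ^ N = 1 := by rw [← pow_mul, mul_comm, pow_mul, hξ, one_pow]
  have hq : 0 < p ^ α := pow_pos (Fact.out : p.Prime).pos _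
  have hq0 : ((p ^ α : ℕ) : K) ≠ 0 := by exact_mod_cast hq.ne'
  -- Temperedness is inherited from `loc^∨`, whose value on `har` is `harLoc`.
  have hf : IsTempered (fun m : ℕ+ => harLoc (N := N) (ξ ^ p ^ α) m) := by
    have h := isTempered_locDualMap p hpN hη (fun m : ℕ+ => har (N := N) (ξ ^ p ^ α) m)
    have he : locDualMap (ξ ^ p ^ α) (fun m : ℕ+ => har (N := N) (ξ ^ p ^ α) m) =
        fun m : ℕ+ => harLoc (ξ ^ p ^ α) m := funext fun m => locDual_har hη m.pos
    rwa [he] at h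
  funext m w
  have hm0 : ((m : ℕ) : K) ≠ 0 := by exact_mod_cast m.ne_zero
  have hS := summable_actTerm p hpN hξ hα (isSummableSeq_har p hξ α) hf m w.weight w.2
    w.1.length w.absWeight
  have hp1 : (p : ℝ)⁻¹ < 1 :=
    inv_lt_one_of_one_lt₀ (by exact_mod_cast (Fact.out : p.Prime).one_lt)
  have ht := tsum_actTerm hξ hq (fun r hr hrq => (norm_pow_div_le p hr.ne' hrq).trans_lt hp1)
    (IsUltrametricDist.norm_natCast_le_one K) (k' := w.2) m.pos
    -- The power of `m` in the action cancels the weight of `v`, leaving that of `w` and the last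
    -- root of unity.
    (κ := ((m : ℕ) : K) ^ w.weight * (1 / rootPow (ξ ^ p ^ α) w.2) ^ (m : ℕ))
    (g := locDual ξ (p ^ α) (har ξ (p ^ α)))
    (fun B k => by
      rw [groupFactor, locDual_har hξ hq]
      split_ifs with h
      · subst h
        simp [LocWord.weight, iterSum]
      · rw [harLoc, locSum, one_div, inv_pow, ← rootPow_pow]
        have := rootPow_ne_zero hη k
        field_simp)
    (F := fun v => ((m : ℕ) : K) ^ (w.weight - v.weight) * harLoc (ξ ^ p ^ α) m v)
    (fun out => by
      simp only [harLoc, locSum]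
      rw [zpow_sub₀ hm0]
      have := zpow_ne_zero (LocWord.weight (out, w.2)) hm0
      field_simp)
    hS w.1 (fun _ ha => List.single_le_sum (by simp) _ (List.mem_map.2 ⟨_, ha, rfl⟩)) w.2 [] 0 []
    (by simp) (by simp) (by simp) (by simp) (fun _ _ => rfl)
  refine Eq.trans ?_ ht.symm
  rw [nestSum, blockSum_nil_zero hξ, iterSumZero_of_pos _ _ _ (Nat.mul_pos hq m.pos), harLoc, locSum,
    rootPow_pow, Nat.cast_mul, mul_zpow, pow_mul, ← one_div_pow]
  have : LocWord.weight (w.1, w.2) = w.weight := rfl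
  rw [this]
  ring

end Identity

end HarmonicAction

theorem mainTheorem4 (p : ℕ) [Fact p.Prime] (N : ℕ) [NeZero N] (hpN : p.Coprime N)
    {K : Type*} [NormedField K] [NormedAlgebra ℚ_[p] K] [CompleteSpace K]
    (ξ : K) (hξ : IsPrimitiveRoot ξ N) (α : ℕ) (hα : 0 < α) :
    -- the action localized at the source and at the target is well defined
    (∀ (g : HarmonicAction.HarWord N → K) (f : ℕ+ → HarmonicAction.LocWord N → K),
      HarmonicAction.IsSummableSeq g → HarmonicAction.IsTempered f →
        ∀ (m : ℕ+) (w : HarmonicAction.LocWord N),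
          Summable (HarmonicAction.actionTerm p α ξ g f m w)) ∧
    -- the action localized at the target is well defined, for every second argument
    (∀ f : ℕ+ → HarmonicAction.HarWord N → K,
      HarmonicAction.IsTempered (HarmonicAction.locDualMap (ξ ^ p ^ α) f)) ∧
    -- the sequences of multiple harmonic sums are in the domains
    HarmonicAction.IsSummableSeq (HarmonicAction.har (N := N) ξ (p ^ α)) ∧
    HarmonicAction.IsTempered
      (fun m : ℕ+ => HarmonicAction.harLoc (N := N) (ξ ^ p ^ α) m) ∧
    -- the equation relating localized multiple harmonic sums that the first action encodes
    (fun m : ℕ+ => HarmonicAction.harLoc (N := N) ξ (p ^ α * m)) =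
      HarmonicAction.actionLocLoc p α ξ (HarmonicAction.har ξ (p ^ α))
        (fun m : ℕ+ => HarmonicAction.harLoc (ξ ^ p ^ α) m) ∧
    -- the map dual to localization sends multiple harmonic sums to localized ones
    HarmonicAction.locDualMap (ξ ^ p ^ α)
        (fun m : ℕ+ => HarmonicAction.har (N := N) (ξ ^ p ^ α) m) =
      (fun m : ℕ+ => HarmonicAction.harLoc (ξ ^ p ^ α) m) ∧
    -- the equation for the action localized at the target
    (fun m : ℕ+ => HarmonicAction.harLoc (N := N) ξ (p ^ α * m)) =
      HarmonicAction.actionTarget p α ξ (HarmonicAction.har ξ (p ^ α))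
        (fun m : ℕ+ => HarmonicAction.har (ξ ^ p ^ α) m) := by

  have := HarmonicAction.charZero_of_padic p (K := K)
  have hη : (ξ ^ p ^ α) ^ N = 1 := by rw [← pow_mul, mul_comm, pow_mul, hξ.pow_eq_one, one_pow]
  have hloc : HarmonicAction.locDualMap (ξ ^ p ^ α)
        (fun m : ℕ+ => HarmonicAction.har (N := N) (ξ ^ p ^ α) m) =
      (fun m : ℕ+ => HarmonicAction.harLoc (ξ ^ p ^ α) m) :=
    funext fun m => HarmonicAction.locDual_har hη m.pos
  have hid := HarmonicAction.harLoc_mul_eq_actionLocLoc (N := N) p hpN hξ.pow_eq_one hα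
  refine ⟨fun g f hg hf m w =>
      HarmonicAction.summable_actionTerm p hpN hξ.pow_eq_one hα hg hf m w,
    HarmonicAction.isTempered_locDualMap p hpN hη,
    HarmonicAction.isSummableSeq_har p hξ.pow_eq_one α, ?_, hid, hloc, ?_⟩
  · rw [← hloc]
    exact HarmonicAction.isTempered_locDualMap p hpN hη _
  · rw [HarmonicAction.actionTarget, hloc]
    exact hid
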